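/- All manifolds are smooth, finite-dimensional, Hausdorff, second countable and without boundary. Let $R$ and $M$ be manifolds, $R\neq\emptyset$, and let $G$ be a Lie group. **Composite bundles.** A principal composite bundle over $(R,M,G)$ consists of a principal $G$-bundle $\pi_P:P\to M$ (right action; the structure bundle), a smooth map $\pi_S:S\to R$ and a principal $G$-bundle $\pi_+:P_+\to S$, such that every point of $R$ has an open neighbourhood $V$ with a diffeomorphism $\chi:\pi_S^{-1}(V)\to V\times M$ over $V$ and a $G$-equivariant diffeomorphism $\chi^*:V\times P\to\pi_+^{-1}(\pi_S^{-1}(V))$ that satisfies $\pi_+(\chi^*_y(p))=\chi_y^{-1}(\pi_P(p))$, where $\chi_y$, $\chi^*_y$ denote the restrictions over $y\in V$. Let $\mathcal U=\{U^\alpha\}$ and $\mathcal V=\{V^i\}$ be open covers of $M$ and of $R$. An atlas over $(\mathcal U,\mathcal V)$ of a composite bundle consists of principal local trivialisations $\phi_P^\alpha:U^\alpha\times G\to\pi_P^{-1}(U^\alpha)$ and of pairs $(\chi^i,\chi^{i*})$ as above over the $V^i$. Put $\phi^{\alpha i}_{++}(x,y,h)=\chi^{i*}_y(\phi^\alpha_P(x,h))$,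 and $\phi_+^{\alpha i}(s,h)=\phi_{++}^{\alpha i}(\chi^i_{\pi_S(s)}(s),\pi_S(s),h)$. The torsion functions of the atlas are $\varphi^{ij}_y=\chi^j_y\circ(\chi^i_y)^{-1}:M\to M$ for $y\in V^i\cap V^j$, and its transition functions $g_{++}^{(\alpha i)(\beta j)}$ are defined by $$\phi^{\beta j}_{++}(\varphi^{ij}_y(x),y,e)=\phi^{\alpha i}_{++}\bigl(x,y,g^{(\alpha i)(\beta j)}_{++}(x,y)\bigr)$$ on $D^{(\alpha i)(\beta j)}=\{(x,y): y\in V^i\cap V^j,\ x\in U^\alpha,\ \varphi^{ij}_y(x)\in U^\beta\}$. **Local data.** Local data over $(\mathcal U,\mathcal V)$ consist of diffeomorphisms $\varphi^{ij}_y$ of $M$ for $y\in V^i\cap V^j$, smooth in $(y,x)$, with $\varphi^{jk}_y\circ\varphi^{ij}_y=\varphi^{ik}_y$ for $y\in V^i\cap V^j\cap V^k$, and of smooth functions $g^{(\alpha i)(\beta j)}_{++}:D^{(\alpha i)(\beta j)}\to G$, such that $g^{(\alpha i)(\beta i)}_{++}(x,y)$ does not depend on $y\in V^i$ nor on $i$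 (for $x \in U^\alpha\cap U^\beta$), and such that the twisted cocycle relation $$g^{(\alpha i)(\beta j)}_{++}(x,y)\,g^{(\beta j)(\gamma k)}_{++}(\varphi^{ij}_y(x),y)=g^{(\alpha i)(\gamma k)}_{++}(x,y)$$ holds whenever $y\in V^i\cap V^j\cap V^k$, $x\in U^\alpha$, $\varphi^{ij}_y(x)\in U^\beta$ and $\varphi^{ik}_y(x)\in U^\gamma$. **Proposition (a composite principal bundle is completely determined by local data).** 0. Every principal composite bundle over $(R,M,G)$ has an atlas over some pair of good open covers (covers by contractible open sets) of $M$ and of $R$. For all open covers $\mathcal U$ of $M$ and $\mathcal V$ of $R$: 1. The torsion functions and transition functions of an atlas over $(\mathcal U,\mathcal V)$ of a principal composite bundle are local data over $(\mathcal U,\mathcal V)$. 2. All local data over $(\mathcal U,\mathcal V)$ are those of some atlas over $(\mathcal U,\mathcal V)$ of some principal composite bundle. 3. For any two principal composite bundles with atlases over $(\mathcal U,\mathcal V)$ that have the same local data there is exactly one isomorphism between them (diffeomorphisms $P\to P'$, $S\to S'$, $P_+\to P_+'$ which commute with all projections, are the identity on $M$ and $R$, and are $G$-equivariant on $P$ and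 $P_+$) that carries $\phi_P^\alpha$, $\chi^i$, $\chi^{i*}$ to the corresponding maps of the second bundle. 4. $S$ and $P_+$ are rebuilt by gluing. Given local data, the relation $(i,y,x)\sim(j,y',x')\iff y=y'$ and $x'=\varphi^{ij}_y(x)$ on $\bigsqcup_i V^i\times M$ is an equivalence relation. Let $\hat S$ be its quotient space, and let $W^{\alpha i}\subset\hat S$ be the image of $\{i\}\times V^i\times U^\alpha$. The relation $(\alpha,i,s,h)\sim(\beta,j,s',h')\iff s=s'$ and $h=g^{(\alpha i)(\beta j)}_{++}(x,y)\,h'$, where $s=[i,y,x]$, on $\bigsqcup_{\alpha,i}W^{\alpha i}\times G$ is an equivalence relation. Let $\hat P_+$ be its quotient space. For every principal composite bundle with an atlas that has these local data, $[i,y,x]\mapsto(\chi^i_y)^{-1}(x)$ is a well-defined homeomorphism $\hat S\to S$, and $[\alpha,i,s,h]\mapsto\phi^{\alpha i}_+(s,h)$ (with $\hat S$ identified with $S$ by the former) is a well-defined homeomorphism $\hat P_+\to P_+$. -/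

import Mathlib

open scoped Manifold ContDiff

universe u

/-- A smooth manifold: Hausdorff, second countable, without boundary, modelled on a
finite-dimensional real normed space. -/
structure SmoothManifold : Type (u + 1) where
  carrier : Type u
  model : Type u
  [normedAddCommGroup : NormedAddCommGroup model]
  [normedSpace : NormedSpace ℝ model]
  [finiteDimensional : FiniteDimensional ℝ model]
  [topologicalSpace : TopologicalSpace carrier]
  [chartedSpace : ChartedSpace model carrier]
  [isManifold : IsManifold 𝓘(ℝ, model) ∞ carrier]
  [t2Space : T2Space carrier]
  [secondCountableTopology : SecondCountableTopology carrier]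

instance : CoeSort SmoothManifold.{u} (Type u) := ⟨SmoothManifold.carrier⟩

attribute [instance] SmoothManifold.normedAddCommGroup SmoothManifold.normedSpace
  SmoothManifold.finiteDimensional SmoothManifold.topologicalSpace SmoothManifold.chartedSpace
  SmoothManifold.isManifold SmoothManifold.t2Space SmoothManifold.secondCountableTopology

/-- The model with corners (trivial: no boundary) of a smooth manifold. -/
noncomputable abbrev SmoothManifold.I (X : SmoothManifold.{u}) : ModelWithCorners ℝ X.model X.model :=
  𝓘(ℝ, X.model)

/-- An open cover, indexed by `ι`. -/
def IsOpenCoverFamily {X : Type u} [TopologicalSpace X] {ι : Type u} (V : ι → Set X) : Prop :=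
  (∀ i, IsOpen (V i)) ∧ ∀ x, ∃ i, x ∈ V i

/-- A good open cover: an open cover by contractible (hence simply connected) sets. -/
def IsGoodCover {X : Type u} [TopologicalSpace X] {ι : Type u} (V : ι → Set X) : Prop :=
  IsOpenCoverFamily V ∧ ∀ i, ContractibleSpace (V i)

/-- A local trivialisation `proj ⁻¹ (baseSet) ≃ baseSet × F` is smooth when it is a
diffeomorphism. -/
def IsSmoothTrivialization {B F Z : SmoothManifold.{u}} {proj : Z → B}
    (e : Bundle.Trivialization F proj) : Prop :=
  ContMDiffOn Z.I (B.I.prod F.I) ∞ e e.source ∧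
    ContMDiffOn (B.I.prod F.I) Z.I ∞ e.toOpenPartialHomeomorph.symm e.target

/-- A local trivialisation of a space with a right `G`-action (an action of `Gᵐᵒᵖ`) is principal
when it is a diffeomorphism and is equivariant for right multiplication on `G`. -/
def IsPrincipalTrivialization {B Z G : SmoothManifold.{u}} [Group G] [MulAction Gᵐᵒᵖ Z]
    {proj : Z → B} (e : Bundle.Trivialization G proj) : Prop :=
  IsSmoothTrivialization e ∧
    ∀ p ∈ e.source, ∀ g : G, (e (MulOpposite.op g • p)).2 = (e p).2 * g

/-- A smooth principal `G`-bundle over `M`, with right action `p · g = op g • p`. -/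
structure PrincipalBundle (M G : SmoothManifold.{u}) [Group G] [LieGroup G.I ∞ G] :
    Type (u + 1) where
  Tot : SmoothManifold.{u}
  [action : MulAction Gᵐᵒᵖ Tot]
  proj : Tot → M
  contMDiff_proj : ContMDiff Tot.I M.I ∞ proj
  contMDiff_action : ContMDiff (Tot.I.prod G.I) Tot.I ∞
    (fun q : Tot × G => MulOpposite.op q.2 • q.1)
  proj_action : ∀ (p : Tot) (g : G), proj (MulOpposite.op g • p) = proj p
  locally_trivial : ∀ x : M, ∃ e : Bundle.Trivialization G proj,
    x ∈ e.baseSet ∧ IsPrincipalTrivialization e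

attribute [instance] PrincipalBundle.action

section

variable {R M G : SmoothManifold.{u}} [Group G] [LieGroup G.I ∞ G]

/-- Local triviality over `V ⊆ R` of a tower `P₊ → S → R`, with structure bundle `P → M`:
`base` is the diffeomorphism `χ : π_S⁻¹(V) ≃ V × M` over `V`, and `lift` is the inverse of the
diffeomorphism `χ* : V × P ≃ π₊⁻¹(π_S⁻¹(V))`, so that for each `y ∈ V` the map `χ*_y` is an
isomorphism of principal `G`-bundles from `P` onto `P₊` restricted to `π_S⁻¹(y)`, which covers
`χ_y⁻¹ : M ≃ π_S⁻¹(y)`. -/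
structure CompositeTrivialization (P : PrincipalBundle M G) {S : SmoothManifold.{u}}
    (projS : S → R) (Pplus : PrincipalBundle S G) (V : Set R) where
  base : Bundle.Trivialization M projS
  baseSet_base : base.baseSet = V
  smooth_base : IsSmoothTrivialization base
  lift : Bundle.Trivialization P.Tot (projS ∘ Pplus.proj)
  baseSet_lift : lift.baseSet = V
  smooth_lift : IsSmoothTrivialization lift
  lift_action : ∀ p ∈ lift.source, ∀ g : G,
    (lift (MulOpposite.op g • p)).2 = MulOpposite.op g • (lift p).2
  proj_lift : ∀ p ∈ lift.source, P.proj (lift p).2 = (base (Pplus.proj p)).2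

end

/-- A principal composite `P(M,G)`-bundle `P₊(S,G) → S(R,M) → R`. -/
structure PrincipalCompositeBundle (R M G : SmoothManifold.{u}) [Group G] [LieGroup G.I ∞ G] :
    Type (u + 1) where
  P : PrincipalBundle M G
  S : SmoothManifold.{u}
  projS : S → R
  contMDiff_projS : ContMDiff S.I R.I ∞ projS
  Pplus : PrincipalBundle S G
  locally_trivial : ∀ y : R, ∃ V : Set R, y ∈ V ∧
    Nonempty (CompositeTrivialization P projS Pplus V)

section

variable {R M G : SmoothManifold.{u}} [Group G] [LieGroup G.I ∞ G] {ι κ : Type u}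

/-- Local trivialisations of a principal composite bundle: `φ_P^α` of the structure bundle over
`U α ⊆ M` (`trivP α` is its inverse) and `χ^i`, `χ^{i*}` of the tower over `V i ⊆ R`. -/
structure CompositeAtlas (B : PrincipalCompositeBundle R M G) (U : κ → Set M)
    (V : ι → Set R) where
  trivP : κ → Bundle.Trivialization G B.P.proj
  baseSet_trivP : ∀ α, (trivP α).baseSet = U α
  principal_trivP : ∀ α, IsPrincipalTrivialization (trivP α)
  chi : ∀ i, CompositeTrivialization B.P B.projS B.Pplus (V i)

namespace CompositeAtlas

variable {B : PrincipalCompositeBundle R M G} {U : κ → Set M} {V : ι → Set R}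

/-- `χ^i_y⁻¹ (x)`, for `y ∈ V i`. -/
def chiInv (A : CompositeAtlas B U V) (i : ι) (y : R) (x : M) : B.S :=
  (A.chi i).base.toOpenPartialHomeomorph.symm (y, x)

/-- The torsion function `χ^j_y ∘ χ^i_y⁻¹`, for `y ∈ V i ∩ V j`. -/
def torsion (A : CompositeAtlas B U V) (i j : ι) (y : R) (x : M) : M :=
  ((A.chi j).base (A.chiInv i y x)).2

/-- The local trivialisation `φ₊₊^{αi}(x,y,h) = χ^{i*}_y (φ_P^α(x,h))` of the total twisted
bundle, for `x ∈ U α` and `y ∈ V i`. -/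
def phiTot (A : CompositeAtlas B U V) (α : κ) (i : ι) (x : M) (y : R) (h : G) : B.Pplus.Tot :=
  (A.chi i).lift.toOpenPartialHomeomorph.symm
    (y, (A.trivP α).toOpenPartialHomeomorph.symm (x, h))

/-- The local trivialisation `φ₊^{αi}(s,h) = χ^{i*}_y (φ_P^α(χ^i_y(s),h))`, `y = π_S(s)`, of
`P₊ → S`, for `s ∈ W^{αi}`. -/
def phiPlus (A : CompositeAtlas B U V) (α : κ) (i : ι) (s : B.S) (h : G) : B.Pplus.Tot :=
  A.phiTot α i ((A.chi i).base s).2 (B.projS s) h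

end CompositeAtlas

/-- The domain of `g₊₊^{(αi)(βj)}`: the pairs `(x,y)` with `y ∈ V i ∩ V j`, `x ∈ U α` and
`φ^{ij}_y(x) ∈ U β`. It is `W^{αi} ∩ W^{βj}` read in the coordinates `χ^i`. -/
def twistedOverlap (U : κ → Set M) (V : ι → Set R) (φ : ι → ι → R → M → M)
    (α : κ) (i : ι) (β : κ) (j : ι) : Set (M × R) :=
  {p | p.2 ∈ V i ∧ p.2 ∈ V j ∧ p.1 ∈ U α ∧ φ i j p.2 p.1 ∈ U β}

/-- The local data: torsion automorphisms `φ^{ij}_y` and functions `g₊₊^{(αi)(βj)}`.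
Only the values at `y ∈ V i ∩ V j`, respectively on `twistedOverlap`, matter. -/
structure CompositeLocalData (G : SmoothManifold.{u}) [Group G] (U : κ → Set M)
    (V : ι → Set R) where
  φ : ι → ι → R → (M ≃ₘ⟮M.I, M.I⟯ M)
  contMDiffOn_φ : ∀ i j, ContMDiffOn (R.I.prod M.I) M.I ∞
    (fun p : R × M => φ i j p.1 p.2) ((V i ∩ V j) ×ˢ Set.univ)
  φ_comp : ∀ i j k, ∀ y ∈ V i ∩ V j ∩ V k, ∀ x, φ j k y (φ i j y x) = φ i k y x
  g : κ → ι → κ → ι → M → R → G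
  contMDiffOn_g : ∀ α i β j, ContMDiffOn (M.I.prod R.I) G.I ∞
    (fun p : M × R => g α i β j p.1 p.2)
    (twistedOverlap U V (fun i j y x => φ i j y x) α i β j)
  g_independent : ∀ α β, ∀ x ∈ U α ∩ U β, ∀ i, ∀ y ∈ V i, ∀ i', ∀ y' ∈ V i',
    g α i β i x y = g α i' β i' x y'
  twisted_cocycle : ∀ α i β j γ k, ∀ y ∈ V i ∩ V j ∩ V k, ∀ x ∈ U α,
    φ i j y x ∈ U β → φ i k y x ∈ U γ →
    g α i β j x y * g β j γ k (φ i j y x) y = g α i γ k x y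

/-- The torsion functions and the transition functions of the total twisted bundle, taken in the
given local trivialisations, are those of `D`. -/
structure CompositeAtlas.HasLocalData {B : PrincipalCompositeBundle R M G} {U : κ → Set M}
    {V : ι → Set R} (A : CompositeAtlas B U V) (D : CompositeLocalData G U V) : Prop where
  torsion_eq : ∀ i j, ∀ y ∈ V i ∩ V j, ∀ x, A.torsion i j y x = D.φ i j y x
  transition_eq : ∀ α i β j, ∀ y ∈ V i ∩ V j, ∀ x ∈ U α, D.φ i j y x ∈ U β →
    A.phiTot β j (D.φ i j y x) y 1 = A.phiTot α i x y (D.g α i β j x y)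

/-- An isomorphism of principal composite bundles over the same `R`, `M`, `G`. -/
@[ext]
structure CompositeIso (B B' : PrincipalCompositeBundle R M G) where
  onP : B.P.Tot ≃ₘ⟮B.P.Tot.I, B'.P.Tot.I⟯ B'.P.Tot
  onS : B.S ≃ₘ⟮B.S.I, B'.S.I⟯ B'.S
  onPplus : B.Pplus.Tot ≃ₘ⟮B.Pplus.Tot.I, B'.Pplus.Tot.I⟯ B'.Pplus.Tot
  proj_onP : ∀ p, B'.P.proj (onP p) = B.P.proj p
  projS_onS : ∀ s, B'.projS (onS s) = B.projS s
  proj_onPplus : ∀ q, B'.Pplus.proj (onPplus q) = onS (B.Pplus.proj q)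
  onP_action : ∀ (p : B.P.Tot) (g : G), onP (MulOpposite.op g • p) = MulOpposite.op g • onP p
  onPplus_action : ∀ (q : B.Pplus.Tot) (g : G),
    onPplus (MulOpposite.op g • q) = MulOpposite.op g • onPplus q

/-- The isomorphism carries the local trivialisations `φ_P^α`, `χ^i`, `χ^{i*}` of the first
bundle to those of the second. -/
structure CompositeIso.Preserves {B B' : PrincipalCompositeBundle R M G} {U : κ → Set M}
    {V : ι → Set R} (F : CompositeIso B B') (A : CompositeAtlas B U V)
    (A' : CompositeAtlas B' U V) : Prop where
  trivP : ∀ α, ∀ p ∈ (A.trivP α).source, A'.trivP α (F.onP p) = A.trivP α p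
  base : ∀ i, ∀ s ∈ (A.chi i).base.source, (A'.chi i).base (F.onS s) = (A.chi i).base s
  lift : ∀ i, ∀ q ∈ (A.chi i).lift.source,
    ((A'.chi i).lift (F.onPplus q)).2 = F.onP ((A.chi i).lift q).2

namespace CompositeLocalData

variable {U : κ → Set M} {V : ι → Set R}

/-- The relation on the disjoint union of the `V i × M` with
`(i,y,x) ∼ (j,y',x')` iff `y = y'` and `x' = φ^{ij}_y(x)`. -/
def baseRel (D : CompositeLocalData G U V) (a b : Σ i, V i × M) : Prop :=
  (a.2.1 : R) = b.2.1 ∧ b.2.2 = D.φ a.1 b.1 a.2.1 a.2.2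

/-- The disjoint union of the `V i × M` glued by the torsion automorphisms, with the quotient
topology. -/
abbrev GluedBase (D : CompositeLocalData G U V) : Type u := Quot D.baseRel

/-- `W^{αi}`: the image in the glued space of `{(i,y,x) | y ∈ V i, x ∈ U α}`. -/
def W (D : CompositeLocalData G U V) (a : κ × ι) : Set D.GluedBase :=
  {s | ∃ y : V a.2, ∃ x ∈ U a.1, Quot.mk D.baseRel ⟨a.2, y, x⟩ = s}

/-- The relation on the disjoint union of the `W^{αi} × G` with `(αi,s,h) ∼ (βj,s',h')` iff `s = s'` and
`h = g₊₊^{(αi)(βj)}(x,y) h'`, where `(x,y)` are the coordinates of `s` in the piece `i`. -/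
def totalRel (D : CompositeLocalData G U V) (a b : Σ a : κ × ι, D.W a × G) : Prop :=
  (a.2.1 : D.GluedBase) = b.2.1 ∧
    ∃ (y : V a.1.2) (x : M), Quot.mk D.baseRel ⟨a.1.2, y, x⟩ = (a.2.1 : D.GluedBase) ∧
      a.2.2 = D.g a.1.1 a.1.2 b.1.1 b.1.2 x y * b.2.2

/-- The disjoint union of the `W^{αi} × G` glued by the transition functions, with the quotient
topology. -/
abbrev GluedTotal (D : CompositeLocalData G U V) : Type u := Quot D.totalRel

end CompositeLocalData

end

/-! Local data are the coordinate changes of the tower, and a space with smooth structure is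
determined by its chart ranges and coordinate changes. The inverse of φ₊₊^{αi} is a chart of P₊ with
range V i × (U α × G), and the chart (βj) is reached from (αi) by (y, x, h) ↦ (y, φ^{ij}_y(x),
g(x,y)⁻¹h). On S the changes are the φ^{ij}_y alone. The twisted cocycle relation is the ordinary
one for P₊; the twist appears because x is replaced by φ^{ij}_y(x) when the piece changes. For i = j
the map χ^{i*} cancels, so g^{(αi)(βi)} is a transition function of P and depends on neither y nor
i.

Isomorphisms: if two bundles have the same data, the maps "chart of the first, then inverse chart of
the second" agree on overlaps and glue to diffeomorphisms (`exists_diffeomorph_of_charts`, used for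
P, S and P₊). Compatibility with projections and actions is visible in one chart, and injectivity of
charts gives uniqueness.

Existence: `exists_smoothBundle` builds S from the torsion functions, and
`PrincipalBundle.exists_of_transition` builds P from the values of g at one point of R and P₊ from
all of g. Over V i, P₊ has the transition functions of P by the independence condition, so P₊ is V i
× P there (`exists_compositeTrivialization`).

Quotients: the maps from the disjoint unions to S and P₊ are continuous open surjections whose
fibres are the equivalence classes (`Quot.exists_homeomorph`). -/

namespace OpenPartialHomeomorph

/-! ### Gluing of maps and of smooth structures -/

section Smooth

variable {E E' E'' F F' H H' H'' L L' : Type*}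
  [NormedAddCommGroup E] [NormedSpace ℝ E] [NormedAddCommGroup E'] [NormedSpace ℝ E']
  [NormedAddCommGroup E''] [NormedSpace ℝ E''] [NormedAddCommGroup F] [NormedSpace ℝ F]
  [NormedAddCommGroup F'] [NormedSpace ℝ F']
  [TopologicalSpace H] [TopologicalSpace H'] [TopologicalSpace H''] [TopologicalSpace L]
  [TopologicalSpace L']
  {I : ModelWithCorners ℝ E H} {I' : ModelWithCorners ℝ E' H'} {I'' : ModelWithCorners ℝ E'' H''}
  {J : ModelWithCorners ℝ F L} {J' : ModelWithCorners ℝ F' L'}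
  {X X' X'' Y Y' : Type*}
  [TopologicalSpace X] [ChartedSpace H X] [TopologicalSpace X'] [ChartedSpace H' X']
  [TopologicalSpace X''] [ChartedSpace H'' X''] [TopologicalSpace Y] [ChartedSpace L Y]
  [TopologicalSpace Y'] [ChartedSpace L' Y']

/-- An open partial homeomorphism between manifolds that is smooth with smooth inverse. -/
def IsSmooth (I : ModelWithCorners ℝ E H) (I' : ModelWithCorners ℝ E' H')
    (e : OpenPartialHomeomorph X X') : Prop :=
  ContMDiffOn I I' ∞ e e.source ∧ ContMDiffOn I' I ∞ e.symm e.target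

theorem IsSmooth.symm {e : OpenPartialHomeomorph X X'} (h : e.IsSmooth I I') :
    e.symm.IsSmooth I' I := ⟨h.2, h.1⟩

theorem IsSmooth.trans {e : OpenPartialHomeomorph X X'} {e' : OpenPartialHomeomorph X' X''}
    (h : e.IsSmooth I I') (h' : e'.IsSmooth I' I'') : (e.trans e').IsSmooth I I'' := by
  refine ⟨?_, ?_⟩
  · rw [coe_trans, trans_source]
    exact h'.1.comp (h.1.mono Set.inter_subset_left) fun x hx => hx.2
  · rw [trans_symm_eq_symm_trans_symm, coe_trans, trans_target]
    exact h.2.comp (h'.2.mono Set.inter_subset_left) fun x hx => hx.2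

theorem IsSmooth.prod {e : OpenPartialHomeomorph X X'} {e' : OpenPartialHomeomorph Y Y'}
    (h : e.IsSmooth I I') (h' : e'.IsSmooth J J') :
    (e.prod e').IsSmooth (I.prod J) (I'.prod J') :=
  ⟨h.1.prodMap h'.1, h.2.prodMap h'.2⟩

theorem isSmooth_refl : (OpenPartialHomeomorph.refl X).IsSmooth I I :=
  ⟨contMDiffOn_id, contMDiffOn_id⟩

/-- Open partial homeomorphisms which agree on overlaps, together with their inverses, glue. -/
theorem exists_glue {ι X X' : Type*} [TopologicalSpace X] [TopologicalSpace X']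
    (e : ι → OpenPartialHomeomorph X X')
    (hX : Nonempty (X → X')) (hX' : Nonempty (X' → X))
    (h : ∀ a b x, x ∈ (e a).source → x ∈ (e b).source → e a x = e b x)
    (h' : ∀ a b y, y ∈ (e a).target → y ∈ (e b).target → (e a).symm y = (e b).symm y) :
    ∃ f : OpenPartialHomeomorph X X', f.source = ⋃ a, (e a).source ∧ f.target = ⋃ a, (e a).target ∧
      (∀ a, ∀ x ∈ (e a).source, f x = e a x) ∧ ∀ a, ∀ y ∈ (e a).target, f.symm y = (e a).symm y := by
  classical
  -- Asking for functions instead of points allows empty spaces; `d` and `d'` only give values off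
  -- the sources and targets.
  obtain ⟨d⟩ := hX
  obtain ⟨d'⟩ := hX'
  let f : X → X' := fun x => if hx : ∃ a, x ∈ (e a).source then e hx.choose x else d x
  let f' : X' → X := fun y => if hy : ∃ a, y ∈ (e a).target then (e hy.choose).symm y else d' y
  have hf : ∀ a, ∀ x ∈ (e a).source, f x = e a x := fun a x hx => by
    have hx' : ∃ a, x ∈ (e a).source := ⟨a, hx⟩
    simp only [f, dif_pos hx']
    exact h _ _ _ hx'.choose_spec hx
  have hf' : ∀ a, ∀ y ∈ (e a).target, f' y = (e a).symm y := fun a y hy => by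
    have hy' : ∃ a, y ∈ (e a).target := ⟨a, hy⟩
    simp only [f', dif_pos hy']
    exact h' _ _ _ hy'.choose_spec hy
  refine ⟨{
    toFun := f
    invFun := f'
    source := ⋃ a, (e a).source
    target := ⋃ a, (e a).target
    map_source' := ?_
    map_target' := ?_
    left_inv' := ?_
    right_inv' := ?_
    open_source := isOpen_iUnion fun a => (e a).open_source
    open_target := isOpen_iUnion fun a => (e a).open_target
    continuousOn_toFun := ?_
    continuousOn_invFun := ?_ }, rfl, rfl, hf, hf'⟩
  · intro x hx
    obtain ⟨a, ha⟩ := Set.mem_iUnion.1 hx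
    rw [hf a x ha]
    exact Set.mem_iUnion.2 ⟨a, (e a).map_source ha⟩
  · intro x hx
    obtain ⟨a, ha⟩ := Set.mem_iUnion.1 hx
    rw [hf' a x ha]
    exact Set.mem_iUnion.2 ⟨a, (e a).map_target ha⟩
  · intro x hx
    obtain ⟨a, ha⟩ := Set.mem_iUnion.1 hx
    rw [hf a x ha, hf' a _ ((e a).map_source ha), (e a).left_inv ha]
  · intro x hx
    obtain ⟨a, ha⟩ := Set.mem_iUnion.1 hx
    rw [hf' a x ha, hf a _ ((e a).map_target ha), (e a).right_inv ha]
  · exact ContinuousOn.iUnion_of_isOpen (fun a => (e a).continuousOn.congr (hf a))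
      fun a => (e a).open_source
  · exact ContinuousOn.iUnion_of_isOpen (fun a => (e a).continuousOn_symm.congr (hf' a))
      fun a => (e a).open_target

theorem IsSmooth.of_cover {ι : Type*} {e : ι → OpenPartialHomeomorph X X'}
    {f : OpenPartialHomeomorph X X'} (he : ∀ a, (e a).IsSmooth I I')
    (hs : f.source = ⋃ a, (e a).source) (ht : f.target = ⋃ a, (e a).target)
    (h : ∀ a, ∀ x ∈ (e a).source, f x = e a x)
    (h' : ∀ a, ∀ y ∈ (e a).target, f.symm y = (e a).symm y) : f.IsSmooth I I' := by
  refine ⟨?_, ?_⟩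
  · rw [hs, contMDiffOn_iUnion_iff_of_isOpen fun a => (e a).open_source]
    exact fun a => (he a).1.congr (h a)
  · rw [ht, contMDiffOn_iUnion_iff_of_isOpen fun a => (e a).open_target]
    exact fun a => (he a).2.congr (h' a)

/-- Two spaces with charts into the same space, which have the same ranges and the same
coordinate changes, are diffeomorphic. -/
theorem exists_diffeomorph_of_charts {ι : Type*} (e : ι → OpenPartialHomeomorph X Y)
    (e' : ι → OpenPartialHomeomorph X' Y) (he : ∀ a, (e a).IsSmooth I J)
    (he' : ∀ a, (e' a).IsSmooth I' J) (hc : ∀ x, ∃ a, x ∈ (e a).source)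
    (hc' : ∀ x, ∃ a, x ∈ (e' a).source) (ht : ∀ a, (e a).target = (e' a).target)
    (h : ∀ a b x, x ∈ (e a).source → x ∈ (e b).source →
      (e' a).symm (e a x) = (e' b).symm (e b x))
    (h' : ∀ a b x, x ∈ (e' a).source → x ∈ (e' b).source →
      (e a).symm (e' a x) = (e b).symm (e' b x)) :
    ∃ f : X ≃ₘ⟮I, I'⟯ X', ∀ a, ∀ x ∈ (e a).source, f x ∈ (e' a).source ∧ e' a (f x) = e a x := by
  have hs : ∀ a, ((e a).trans (e' a).symm).source = (e a).source := fun a => by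
    rw [trans_source, symm_source, ← ht, Set.inter_eq_left]
    exact fun x hx => (e a).map_source hx
  have hs' : ∀ a, ((e a).trans (e' a).symm).target = (e' a).source := fun a => by
    rw [trans_target, symm_target, Set.inter_eq_left]
    intro x hx
    simpa [ht a] using (e' a).map_source hx
  obtain ⟨f, hfs, hft, hf, hf'⟩ := exists_glue (fun a => (e a).trans (e' a).symm)
    ⟨fun x => (e' (hc x).choose).symm (e (hc x).choose x)⟩
    ⟨fun x => (e (hc' x).choose).symm (e' (hc' x).choose x)⟩
    (fun a b x hx hx' => by rw [hs] at hx hx'; exact h a b x hx hx')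
    (fun a b x hx hx' => by rw [hs'] at hx hx'; exact h' a b x hx hx')
  have hsm := IsSmooth.of_cover (fun a => (he a).trans (he' a).symm) hfs hft hf hf'
  have h1 : f.source = Set.univ := Set.eq_univ_of_forall fun x => by
    rw [hfs, Set.mem_iUnion]; simpa only [hs] using hc x
  have h2 : f.target = Set.univ := Set.eq_univ_of_forall fun x => by
    rw [hft, Set.mem_iUnion]; simpa only [hs'] using hc' x
  have hc1 : ContMDiff I I' ∞ f := by rw [← contMDiffOn_univ, ← h1]; exact hsm.1
  have hc2 : ContMDiff I' I ∞ f.symm := by rw [← contMDiffOn_univ, ← h2]; exact hsm.2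
  refine ⟨{
    toFun := f
    invFun := f.symm
    left_inv := fun x => f.left_inv (h1 ▸ Set.mem_univ x)
    right_inv := fun x => f.right_inv (h2 ▸ Set.mem_univ x)
    contMDiff_toFun := hc1
    contMDiff_invFun := hc2 }, fun a x hx => ?_⟩
  have hx' : e a x ∈ (e' a).target := ht a ▸ (e a).map_source hx
  have hfx : f x = (e' a).symm (e a x) := hf a x (by rwa [hs])
  change f x ∈ _ ∧ e' a (f x) = _
  rw [hfx]
  exact ⟨(e' a).map_target hx', (e' a).right_inv hx'⟩

/-- A space covered by charts with values in a manifold, with smooth coordinate changes, is a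
manifold. -/
theorem exists_chartedSpace_of_compatible {ι X : Type*} [TopologicalSpace X] [IsManifold J ∞ Y]
    (e : ι → OpenPartialHomeomorph X Y) (hc : ∀ x, ∃ a, x ∈ (e a).source)
    (h : ∀ a b, ContMDiffOn J J ∞ ((e a).symm.trans (e b)) ((e a).symm.trans (e b)).source) :
    ∃ _ : ChartedSpace L X, IsManifold J ∞ X ∧ ∀ a, (e a).IsSmooth J J := by
  let cs : ChartedSpace L X :=
    { atlas := {f | ∃ a, ∃ c ∈ atlas L Y, f = (e a).trans c}
      chartAt := fun x => (e (hc x).choose).trans (chartAt L (e (hc x).choose x))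
      mem_chart_source := fun x => by
        rw [trans_source]
        exact ⟨(hc x).choose_spec, mem_chart_source L _⟩
      chart_mem_atlas := fun x => ⟨_, _, chart_mem_atlas L _, rfl⟩ }
  have hm : IsManifold J ∞ X := by
    refine isManifold_of_contDiffOn J ∞ X ?_
    rintro _ _ ⟨a, c, hc, rfl⟩ ⟨b, c', hc', rfl⟩
    rw [← contMDiffOn_iff_contDiffOn]
    have k1 := contMDiffOn_symm_of_mem_maximalAtlas (I := J) (n := ∞)
      (IsManifold.subset_maximalAtlas hc)
    have k2 := contMDiffOn_of_mem_maximalAtlas (I := J) (n := ∞)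
      (IsManifold.subset_maximalAtlas hc')
    -- The coordinate change is `c'` after the change from `e a` to `e b` after the inverse of `c`;
    -- the middle map is smooth by hypothesis.
    have k3 : ContMDiffOn J J ∞ (((e a).trans c).symm.trans ((e b).trans c'))
        (((e a).trans c).symm.trans ((e b).trans c')).source := by
      refine (k2.comp ((h a b).comp (k1.mono ?_) ?_) ?_).congr ?_
      · exact fun x hx => by simp at hx; tauto
      · exact fun x hx => by simp at hx ⊢; tauto
      · exact fun x hx => by simp at hx ⊢; tauto
      · exact fun x hx => rfl
    have k4 := J.contMDiff (n := ∞)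
    have k5 := J.contMDiffOn_symm (n := ∞)
    exact (k4.comp_contMDiffOn (k3.comp (k5.mono Set.inter_subset_right) fun x hx => hx.1))
  refine ⟨cs, hm, fun b => ?_⟩
  -- On the domain of the chart `(e a).trans c`, the map `e b` is that chart, then the inverse of
  -- `c`, then the change from `e a` to `e b`; each of these is smooth.
  have key : ∀ a b, ∀ c ∈ atlas L Y, ContMDiffOn J J ∞ (e b)
      (((e a).trans c).source ∩ (e b).source) ∧ ContMDiffOn J J ∞ (e b).symm
      ((e b).target ∩ (e b).symm ⁻¹' ((e a).trans c).source) := by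
    intro a b c hc
    have hmem : (e a).trans c ∈ atlas L X := ⟨a, c, hc, rfl⟩
    have k1 := contMDiffOn_of_mem_maximalAtlas (I := J) (n := ∞)
      (IsManifold.subset_maximalAtlas hmem)
    have k2 := contMDiffOn_symm_of_mem_maximalAtlas (I := J) (n := ∞)
      (IsManifold.subset_maximalAtlas hmem)
    have k3 := contMDiffOn_of_mem_maximalAtlas (I := J) (n := ∞)
      (IsManifold.subset_maximalAtlas hc)
    have k4 := contMDiffOn_symm_of_mem_maximalAtlas (I := J) (n := ∞)
      (IsManifold.subset_maximalAtlas hc)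
    refine ⟨((h a b).comp (k4.comp (k1.mono Set.inter_subset_left) ?_) ?_).congr ?_,
      (k2.comp (k3.comp ((h b a).mono ?_) ?_) ?_).congr ?_⟩
    · intro x hx
      simp only [trans_source, Set.mem_inter_iff, Set.mem_preimage] at hx
      simpa using c.map_source hx.1.2
    · intro x hx
      simp only [trans_source, Set.mem_inter_iff, Set.mem_preimage] at hx
      simp [hx, c.left_inv hx.1.2]
    · intro x hx
      simp only [trans_source, Set.mem_inter_iff, Set.mem_preimage] at hx
      simp [hx, c.left_inv hx.1.2]
    · intro x hx
      simp only [trans_source, Set.mem_inter_iff, Set.mem_preimage] at hx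
      simp [hx]
    · intro x hx
      simp only [trans_source, Set.mem_inter_iff, Set.mem_preimage] at hx
      simp [hx]
    · intro x hx
      simp only [trans_source, Set.mem_inter_iff, Set.mem_preimage] at hx
      simp [hx, c.map_source hx.2.2]
    · intro x hx
      simp only [trans_source, Set.mem_inter_iff, Set.mem_preimage] at hx
      simp [hx, c.left_inv hx.2.2]
  refine ⟨fun x hx => ?_, fun y hy => ?_⟩
  · have hmem := mem_chart_source L x
    refine (((key _ b _ (chart_mem_atlas L _)).1 x ⟨hmem, hx⟩).contMDiffAt
      (((chartAt L x).open_source.inter (e b).open_source).mem_nhds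
        ⟨hmem, hx⟩)).contMDiffWithinAt
  · have hmem := mem_chart_source L ((e b).symm y)
    refine (((key _ b _ (chart_mem_atlas L _)).2 y ⟨hy, hmem⟩).contMDiffAt
      (((e b).isOpen_inter_preimage_symm (chartAt L ((e b).symm y)).open_source).mem_nhds
        ⟨hy, hmem⟩)).contMDiffWithinAt

end Smooth

end OpenPartialHomeomorph

/-! ### Smooth and principal bundles from transition functions -/

namespace SmoothManifold

variable {B F : SmoothManifold.{u}}

/-- A smooth fibre bundle with given trivialising cover and given transition functions. -/
theorem exists_smoothBundle {ι : Type u} {W : ι → Set B} (hW : IsOpenCoverFamily W)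
    (t : ι → ι → B → F → F)
    (ht : ∀ a b, ContMDiffOn (B.I.prod F.I) F.I ∞ (fun p : B × F => t a b p.1 p.2)
      ((W a ∩ W b) ×ˢ Set.univ))
    (t_self : ∀ a, ∀ x ∈ W a, ∀ v, t a a x v = v)
    (t_comp : ∀ a b c, ∀ x ∈ W a ∩ W b ∩ W c, ∀ v, t b c x (t a b x v) = t a c x v) :
    ∃ (Z : SmoothManifold.{u}) (proj : Z → B) (e : ι → Bundle.Trivialization F proj),
      ContMDiff Z.I B.I ∞ proj ∧ (∀ a, (e a).baseSet = W a) ∧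
      (∀ a, IsSmoothTrivialization (e a)) ∧
      ∀ a b, ∀ x ∈ W a ∩ W b, ∀ v,
        e b ((e a).toOpenPartialHomeomorph.symm (x, v)) = (x, t a b x v) := by
  choose idx hidx using hW.2
  let C : FiberBundleCore ι B F :=
    { baseSet := W
      isOpen_baseSet := hW.1
      indexAt := idx
      mem_baseSet_at := hidx
      coordChange := t
      coordChange_self := t_self
      continuousOn_coordChange := fun a b => (ht a b).continuousOn
      coordChange_comp := t_comp }
  have hs : ∀ a p, p ∈ (C.localTriv a).source ↔ p.1 ∈ W a := fun a p => Iff.rfl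
  -- The core stores a point over x in the trivialisation `idx x`; the cocycle relation removes this
  -- detour.
  have htr : ∀ a b, ∀ x ∈ W a ∩ W b, ∀ v,
      C.localTriv b ((C.localTriv a).toOpenPartialHomeomorph.symm (x, v)) = (x, t a b x v) := by
    intro a b x hx v
    rw [C.localTriv_symm_apply, C.localTriv_apply]
    exact congrArg (Prod.mk x) (t_comp _ _ _ _ ⟨⟨hx.1, hidx x⟩, hx.2⟩ _)
  have hcov : ∀ z : C.TotalSpace, ∃ a, z ∈ (C.localTriv a).source := fun z =>
    ⟨idx z.1, (hs _ _).2 (hidx _)⟩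
  obtain ⟨cs, hm, hsm⟩ := OpenPartialHomeomorph.exists_chartedSpace_of_compatible
    (J := B.I.prod F.I) (fun a => (C.localTriv a).toOpenPartialHomeomorph) hcov (by
      intro a b
      have hsub : ((C.localTriv a).toOpenPartialHomeomorph.symm.trans
          (C.localTriv b).toOpenPartialHomeomorph).source ⊆ (W a ∩ W b) ×ˢ Set.univ := by
        rintro ⟨x, v⟩ hx
        rw [OpenPartialHomeomorph.trans_source] at hx
        have h1 : x ∈ W a := (C.localTriv a).mem_target.1 hx.1
        refine ⟨⟨h1, ?_⟩, trivial⟩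
        have h2 := (hs _ _).1 hx.2
        rwa [C.localTriv_symm_apply] at h2
      refine ((contMDiffOn_fst.prodMk (ht a b)).mono hsub).congr ?_
      rintro ⟨x, v⟩ hx
      exact htr a b x (hsub hx).1 v)
  have hcontp : Continuous (C.proj : C.TotalSpace → B) := C.continuous_proj
  -- Points over the same base point lie in one trivialisation, whose target is Hausdorff; other
  -- points are separated in the base.
  have hT2 : T2Space C.TotalSpace := by
    refine ⟨fun z z' hne => ?_⟩
    by_cases hp : C.proj z = C.proj z'
    · obtain ⟨a, ha⟩ := hcov z
      have ha' : z' ∈ (C.localTriv a).source := by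
        rw [(C.localTriv a).mem_source] at ha ⊢; rwa [← hp]
      have hne' : C.localTriv a z ≠ C.localTriv a z' := fun h =>
        hne ((C.localTriv a).toOpenPartialHomeomorph.injOn ha ha' h)
      obtain ⟨u, v, hu, hv, hzu, hzv, huv⟩ := t2_separation hne'
      refine ⟨_, _, (C.localTriv a).toOpenPartialHomeomorph.isOpen_inter_preimage hu,
        (C.localTriv a).toOpenPartialHomeomorph.isOpen_inter_preimage hv, ⟨ha, hzu⟩, ⟨ha', hzv⟩, ?_⟩
      exact ((huv.preimage _).mono Set.inter_subset_right Set.inter_subset_right)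
    · obtain ⟨u, v, hu, hv, hzu, hzv, huv⟩ := t2_separation hp
      exact ⟨_, _, hu.preimage hcontp, hv.preimage hcontp, hzu, hzv, huv.preimage _⟩
  -- Countably many trivialising sets cover B, and each source is homeomorphic to an open part of B
  -- × F.
  have hsc : SecondCountableTopology C.TotalSpace := by
    obtain ⟨s, hsc, hsU⟩ := TopologicalSpace.countable_cover_nhds
      (f := fun x => W (idx x)) fun x => (hW.1 _).mem_nhds (hidx x)
    have : Countable s := hsc.to_subtype
    have (x : s) : SecondCountableTopology (C.localTriv (idx x)).source :=
      (C.localTriv (idx x)).toOpenPartialHomeomorph.toHomeomorphSourceTarget.secondCountableTopology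
    refine TopologicalSpace.secondCountableTopology_of_countable_cover
      (U := fun x : s => (C.localTriv (idx x)).source) (fun x => (C.localTriv _).open_source)
      (Set.eq_univ_of_forall fun z => ?_)
    have hz : z.1 ∈ ⋃ x ∈ s, W (idx x) := hsU ▸ Set.mem_univ _
    simp only [Set.mem_iUnion] at hz
    obtain ⟨x, hx, hz⟩ := hz
    exact Set.mem_iUnion.2 ⟨⟨x, hx⟩, (hs _ _).2 hz⟩
  let cs' : ChartedSpace (B.model × F.model) C.TotalSpace := cs
  have hm' : IsManifold 𝓘(ℝ, B.model × F.model) ∞ C.TotalSpace := by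
    rw [modelWithCornersSelf_prod]; exact hm
  let Z : SmoothManifold.{u} :=
    { carrier := C.TotalSpace
      model := B.model × F.model
      chartedSpace := cs' }
  have hsmooth : ∀ a, IsSmoothTrivialization (B := B) (F := F) (Z := Z) (C.localTriv a) := fun a => by
    -- With K a variable, the equality of the two models with corners on the product can be
    -- substituted.
    have h : ∀ K : ModelWithCorners ℝ (B.model × F.model) (B.model × F.model), K = B.I.prod F.I →
        (C.localTriv a).toOpenPartialHomeomorph.IsSmooth K (B.I.prod F.I) := by
      rintro _ rfl
      exact hsm a
    exact h _ modelWithCornersSelf_prod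
  refine ⟨Z, C.proj, C.localTriv, ?_, fun a => rfl, hsmooth, htr⟩
  intro z
  obtain ⟨a, ha⟩ := hcov z
  have hn := (C.localTriv a).open_source.mem_nhds ha
  refine ContMDiffAt.congr_of_eventuallyEq (f := fun z => (C.localTriv a z).1) ?_ ?_
  · exact contMDiffAt_fst.comp z ((hsmooth a).1.contMDiffAt hn)
  · filter_upwards [hn] with z' hz'
    exact ((C.localTriv a).coe_fst hz').symm

end SmoothManifold

namespace PrincipalBundle

variable {B G : SmoothManifold.{u}} [Group G] [LieGroup G.I ∞ G]

/-- A principal bundle with given trivialising cover and given transition functions. -/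
theorem exists_of_transition {ι : Type u} {W : ι → Set B} (hW : IsOpenCoverFamily W)
    (c : ι → ι → B → G) (hc : ∀ a b, ContMDiffOn B.I G.I ∞ (c a b) (W a ∩ W b))
    (c_comp : ∀ a b d, ∀ x ∈ W a ∩ W b ∩ W d, c b d x * c a b x = c a d x) :
    ∃ (P : PrincipalBundle B G) (e : ι → Bundle.Trivialization G P.proj),
      (∀ a, (e a).baseSet = W a) ∧ (∀ a, IsPrincipalTrivialization (e a)) ∧
      ∀ a b, ∀ x ∈ W a ∩ W b, ∀ v,
        e b ((e a).toOpenPartialHomeomorph.symm (x, v)) = (x, c a b x * v) := by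
  have c_self : ∀ a, ∀ x ∈ W a, c a a x = 1 := fun a x hx =>
    mul_eq_left.1 (c_comp a a a x ⟨⟨hx, hx⟩, hx⟩)
  obtain ⟨Z, proj, e, hproj, hbase, hsm, htr⟩ := SmoothManifold.exists_smoothBundle (F := G) hW
    (fun a b x v => c a b x * v)
    (fun a b => ((hc a b).comp contMDiffOn_fst fun p hp => hp.1).mul contMDiffOn_snd)
    (fun a x hx v => by simp [c_self a x hx])
    (fun a b d x hx v => by rw [← mul_assoc, c_comp a b d x hx])
  choose idx hidx using hW.2
  have hs : ∀ a z, z ∈ (e a).source ↔ proj z ∈ W a := fun a z => by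
    rw [(e a).mem_source, hbase]
  -- Right multiplication in one coordinate. Coordinate changes multiply on the left and commute
  -- with it, so by `e_act` the formula holds in every trivialisation.
  let act : G → Z → Z := fun g z => (e (idx (proj z))).toOpenPartialHomeomorph.symm
    (proj z, (e (idx (proj z)) z).2 * g)
  have proj_act : ∀ g z, proj (act g z) = proj z := fun g z =>
    (e _).proj_symm_apply' (by rw [hbase]; exact hidx _)
  have e_act : ∀ a g z, proj z ∈ W a → e a (act g z) = (proj z, (e a z).2 * g) := by
    intro a g z hz
    have h1 := htr _ a (proj z) ⟨hidx _, hz⟩ (e (idx (proj z)) z).2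
    rw [(e _).symm_apply_mk_proj ((hs _ _).2 (hidx _))] at h1
    rw [htr _ a (proj z) ⟨hidx _, hz⟩, h1, mul_assoc]
  have e_inj : ∀ a z z', proj z ∈ W a → proj z' ∈ W a → e a z = e a z' → z = z' :=
    fun a z z' hz hz' h => (e a).toOpenPartialHomeomorph.injOn ((hs _ _).2 hz) ((hs _ _).2 hz') h
  have one_act : ∀ z, act 1 z = z := fun z => by
    have hz := hidx (proj z)
    refine e_inj (idx (proj z)) _ _ (by rw [proj_act]; exact hz) hz ?_
    rw [e_act _ _ _ hz, mul_one, (e _).mk_proj_snd ((hs _ _).2 hz)]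
  have mul_act : ∀ g g' z, act (g' * g) z = act g (act g' z) := fun g g' z => by
    have hz := hidx (proj z)
    refine e_inj (idx (proj z)) _ _ (by rw [proj_act]; exact hz)
      (by rw [proj_act, proj_act]; exact hz) ?_
    rw [e_act _ _ _ hz, e_act _ _ _ (by rw [proj_act]; exact hz), e_act _ _ _ hz, proj_act,
      mul_assoc]
  let inst : MulAction Gᵐᵒᵖ Z :=
    { smul := fun g z => act g.unop z
      one_smul := one_act
      mul_smul := fun g g' z => mul_act g.unop g'.unop z }
  have hprin : ∀ a, IsPrincipalTrivialization (e a) := fun a => ⟨hsm a, fun p hp g => by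
    change (e a (act g p)).2 = _
    rw [e_act a g p ((hs _ _).1 hp)]⟩
  refine ⟨{
    Tot := Z
    proj := proj
    contMDiff_proj := hproj
    contMDiff_action := ?_
    proj_action := fun p g => proj_act g p
    locally_trivial := fun x => ⟨e (idx x), by rw [hbase]; exact hidx x, hprin _⟩ }, e, hbase,
    hprin, htr⟩
  rintro ⟨z, g⟩
  have hz := hidx (proj z)
  set a := idx (proj z)
  have hopen : IsOpen (Prod.fst ⁻¹' (e a).source : Set (Z × G)) :=
    (e a).open_source.preimage continuous_fst
  -- The index `idx (proj z)` inside `act` may jump with z; smoothness is proved for the formula in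
  -- the fixed trivialisation `a`, which agrees with `act` near z.
  have key : ContMDiffOn (Z.I.prod G.I) Z.I ∞ (fun q : Z × G =>
      (e a).toOpenPartialHomeomorph.symm (proj q.1, (e a q.1).2 * q.2))
      (Prod.fst ⁻¹' (e a).source) := by
    refine (hsm a).2.comp (ContMDiffOn.prodMk ?_ (ContMDiffOn.mul ?_ contMDiffOn_snd)) ?_
    · exact (hproj.comp contMDiff_fst).contMDiffOn
    · exact contMDiff_snd.comp_contMDiffOn ((hsm a).1.comp contMDiffOn_fst fun q hq => hq)
    · intro q hq
      exact (e a).mem_target.2 ((e a).mem_source.1 hq)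
  refine ((key.congr ?_).contMDiffAt (hopen.mem_nhds ((hs _ _).2 hz)))
  intro q hq
  have hq' := (hs _ _).1 hq
  change act q.2 q.1 = _
  refine e_inj a _ _ (by rw [proj_act]; exact hq') ?_ ?_
  · rw [(e a).proj_symm_apply' (by rwa [hbase])]; exact hq'
  · rw [e_act _ _ _ hq', (e a).apply_symm_apply' (by rwa [hbase])]

variable {P : PrincipalBundle B G} {e : Bundle.Trivialization G P.proj}

theorem smul_symm_apply (he : IsPrincipalTrivialization e) {x : B} (hx : x ∈ e.baseSet) (h g : G) :
    MulOpposite.op g • e.toOpenPartialHomeomorph.symm (x, h) =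
      e.toOpenPartialHomeomorph.symm (x, h * g) := by
  have hp : e.toOpenPartialHomeomorph.symm (x, h) ∈ e.source := e.map_target (e.mem_target.2 hx)
  have hp' : MulOpposite.op g • e.toOpenPartialHomeomorph.symm (x, h) ∈ e.source := by
    rw [e.mem_source, P.proj_action, e.proj_symm_apply' hx]; exact hx
  refine e.toOpenPartialHomeomorph.injOn hp' (e.map_target (e.mem_target.2 hx)) ?_
  change e _ = e _
  rw [e.apply_symm_apply' hx]
  refine Prod.ext ?_ ?_
  · rw [e.coe_fst hp', P.proj_action, e.proj_symm_apply' hx]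
  · rw [he.2 _ hp, e.apply_symm_apply' hx]

end PrincipalBundle

/-! ### Calculus in the coordinates of an atlas -/

section

variable {R M G : SmoothManifold.{u}} [Group G] [LieGroup G.I ∞ G] {ι κ : Type u}

namespace CompositeTrivialization

variable {P : PrincipalBundle M G} {S : SmoothManifold.{u}} {projS : S → R}
  {Pplus : PrincipalBundle S G} {V : Set R} (C : CompositeTrivialization P projS Pplus V)

theorem mem_base_source {s : S} : s ∈ C.base.source ↔ projS s ∈ V := by
  rw [C.base.mem_source, C.baseSet_base]

theorem mem_base_target {p : R × M} : p ∈ C.base.target ↔ p.1 ∈ V := by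
  rw [C.base.mem_target, C.baseSet_base]

theorem mem_lift_source {q : Pplus.Tot} : q ∈ C.lift.source ↔ projS (Pplus.proj q) ∈ V := by
  rw [C.lift.mem_source, C.baseSet_lift, Function.comp_apply]

theorem mem_lift_target {p : R × P.Tot} : p ∈ C.lift.target ↔ p.1 ∈ V := by
  rw [C.lift.mem_target, C.baseSet_lift]

theorem base_apply {s : S} (hs : projS s ∈ V) : C.base s = (projS s, (C.base s).2) :=
  Prod.ext (C.base.coe_fst (C.mem_base_source.2 hs)) rfl

theorem lift_apply {q : Pplus.Tot} (hq : projS (Pplus.proj q) ∈ V) :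
    C.lift q = (projS (Pplus.proj q), (C.lift q).2) :=
  Prod.ext (C.lift.coe_fst (C.mem_lift_source.2 hq)) rfl

theorem projS_base_symm {y : R} (hy : y ∈ V) (x : M) :
    projS (C.base.toOpenPartialHomeomorph.symm (y, x)) = y :=
  C.base.proj_symm_apply' (by rwa [C.baseSet_base])

theorem base_base_symm {y : R} (hy : y ∈ V) (x : M) :
    C.base (C.base.toOpenPartialHomeomorph.symm (y, x)) = (y, x) :=
  C.base.apply_symm_apply' (by rwa [C.baseSet_base])

theorem lift_lift_symm {y : R} (hy : y ∈ V) (p : P.Tot) :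
    C.lift (C.lift.toOpenPartialHomeomorph.symm (y, p)) = (y, p) :=
  C.lift.apply_symm_apply' (by rwa [C.baseSet_lift])

/-- The condition on χ* itself, recovered from `proj_lift`, which is stated for its inverse. -/
theorem proj_lift_symm {y : R} (hy : y ∈ V) (p : P.Tot) :
    Pplus.proj (C.lift.toOpenPartialHomeomorph.symm (y, p)) =
      C.base.toOpenPartialHomeomorph.symm (y, P.proj p) := by
  have hq : C.lift.toOpenPartialHomeomorph.symm (y, p) ∈ C.lift.source :=
    C.lift.map_target (C.mem_lift_target.2 hy)
  have hs := C.mem_lift_source.1 hq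
  have hy' : projS (Pplus.proj (C.lift.toOpenPartialHomeomorph.symm (y, p))) = y :=
    C.lift.proj_symm_apply' (by rwa [C.baseSet_lift])
  have h := C.proj_lift _ hq
  rw [C.lift_lift_symm hy] at h
  have h2 := C.base.symm_apply_mk_proj (C.mem_base_source.2 hs)
  rw [hy', ← h] at h2
  exact h2.symm

end CompositeTrivialization

namespace CompositeAtlas

variable {B : PrincipalCompositeBundle R M G} {U : κ → Set M} {V : ι → Set R}
  (A : CompositeAtlas B U V)

/-- The chart of the total space with values in `R × (M × G)`, inverse to `φ₊₊^{αi}`. -/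
noncomputable def chart (α : κ) (i : ι) : OpenPartialHomeomorph B.Pplus.Tot (R × (M × G)) :=
  (A.chi i).lift.toOpenPartialHomeomorph.trans
    ((OpenPartialHomeomorph.refl R).prod (A.trivP α).toOpenPartialHomeomorph)

theorem isSmooth_chart (α : κ) (i : ι) :
    (A.chart α i).IsSmooth B.Pplus.Tot.I (R.I.prod (M.I.prod G.I)) :=
  OpenPartialHomeomorph.IsSmooth.trans (A.chi i).smooth_lift
    (OpenPartialHomeomorph.isSmooth_refl.prod (A.principal_trivP α).1)

theorem mem_trivP_source {α : κ} {p : B.P.Tot} :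
    p ∈ (A.trivP α).source ↔ B.P.proj p ∈ U α := by
  rw [(A.trivP α).mem_source, A.baseSet_trivP]

/-- By `proj_lift` the P-component of the lift lies over the M-component of χ^i, so the chart domain
is the full preimage of W^{αi} in P₊. -/
theorem mem_chart_source {α : κ} {i : ι} {q : B.Pplus.Tot} :
    q ∈ (A.chart α i).source ↔
      B.projS (B.Pplus.proj q) ∈ V i ∧ ((A.chi i).base (B.Pplus.proj q)).2 ∈ U α := by
  simp only [chart, OpenPartialHomeomorph.trans_source, OpenPartialHomeomorph.prod_source,
    OpenPartialHomeomorph.refl_source, Set.mem_inter_iff, Set.mem_preimage, Set.mem_prod,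
    Set.mem_univ, true_and]
  change q ∈ (A.chi i).lift.source ∧ ((A.chi i).lift q).2 ∈ (A.trivP α).source ↔ _
  rw [A.mem_trivP_source, ← (A.chi i).mem_lift_source]
  exact and_congr_right fun hq => by rw [(A.chi i).proj_lift q hq]

theorem mem_chart_target {α : κ} {i : ι} {p : R × (M × G)} :
    p ∈ (A.chart α i).target ↔ p.1 ∈ V i ∧ p.2.1 ∈ U α := by
  simp only [chart, OpenPartialHomeomorph.trans_target, OpenPartialHomeomorph.prod_target,
    OpenPartialHomeomorph.refl_target, Set.mem_inter_iff, Set.mem_preimage, Set.mem_prod,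
    Set.mem_univ, true_and]
  change p.2 ∈ (A.trivP α).target ∧
    (p.1, (A.trivP α).toOpenPartialHomeomorph.symm p.2) ∈ (A.chi i).lift.target ↔ _
  rw [(A.trivP α).mem_target, (A.chi i).mem_lift_target, A.baseSet_trivP]
  exact and_comm

theorem chart_symm_apply (α : κ) (i : ι) (y : R) (x : M) (h : G) :
    (A.chart α i).symm (y, (x, h)) = A.phiTot α i x y h := rfl

theorem chart_apply {α : κ} {i : ι} {q : B.Pplus.Tot} (hq : q ∈ (A.chart α i).source) :
    A.chart α i q = (B.projS (B.Pplus.proj q), (((A.chi i).base (B.Pplus.proj q)).2,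
      (A.trivP α ((A.chi i).lift q).2).2)) := by
  have h := A.mem_chart_source.1 hq
  have h1 := (A.chi i).proj_lift q ((A.chi i).mem_lift_source.2 h.1)
  refine Prod.ext ((A.chi i).lift.coe_fst ((A.chi i).mem_lift_source.2 h.1)) (Prod.ext ?_ rfl)
  change (A.trivP α ((A.chi i).lift q).2).1 = _
  rw [(A.trivP α).coe_fst (A.mem_trivP_source.2 (by rw [h1]; exact h.2)), h1]

theorem chart_phiTot {α : κ} {i : ι} {y : R} {x : M} (hy : y ∈ V i) (hx : x ∈ U α) (h : G) :
    A.chart α i (A.phiTot α i x y h) = (y, (x, h)) :=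
  (A.chart α i).right_inv (x := (y, (x, h))) (A.mem_chart_target.2 ⟨hy, hx⟩)

theorem phiTot_mem_source {α : κ} {i : ι} {y : R} {x : M} (hy : y ∈ V i) (hx : x ∈ U α) (h : G) :
    A.phiTot α i x y h ∈ (A.chart α i).source :=
  (A.chart α i).map_target (x := (y, (x, h))) (A.mem_chart_target.2 ⟨hy, hx⟩)

theorem exists_eq_phiTot {α : κ} {i : ι} {q : B.Pplus.Tot} (hq : q ∈ (A.chart α i).source) :
    ∃ h, q = A.phiTot α i ((A.chi i).base (B.Pplus.proj q)).2 (B.projS (B.Pplus.proj q)) h :=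
  ⟨(A.trivP α ((A.chi i).lift q).2).2, by
    rw [← chart_symm_apply, ← A.chart_apply hq, (A.chart α i).left_inv hq]⟩

theorem projS_chiInv {i : ι} {y : R} (hy : y ∈ V i) (x : M) : B.projS (A.chiInv i y x) = y :=
  (A.chi i).projS_base_symm hy x

theorem base_chiInv {i : ι} {y : R} (hy : y ∈ V i) (x : M) :
    (A.chi i).base (A.chiInv i y x) = (y, x) :=
  (A.chi i).base_base_symm hy x

theorem chiInv_base {i : ι} {s : B.S} (hs : B.projS s ∈ V i) :
    A.chiInv i (B.projS s) ((A.chi i).base s).2 = s :=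
  (A.chi i).base.symm_apply_mk_proj ((A.chi i).mem_base_source.2 hs)

theorem proj_trivP_symm {α : κ} {x : M} (hx : x ∈ U α) (h : G) :
    B.P.proj ((A.trivP α).toOpenPartialHomeomorph.symm (x, h)) = x :=
  (A.trivP α).proj_symm_apply' (by rwa [A.baseSet_trivP])

theorem proj_phiTot {α : κ} {i : ι} {y : R} {x : M} (hy : y ∈ V i) (hx : x ∈ U α) (h : G) :
    B.Pplus.proj (A.phiTot α i x y h) = A.chiInv i y x := by
  rw [phiTot, (A.chi i).proj_lift_symm hy, A.proj_trivP_symm hx, chiInv]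

theorem lift_phiTot {α : κ} {i : ι} {y : R} (hy : y ∈ V i) (x : M) (h : G) :
    ((A.chi i).lift (A.phiTot α i x y h)) =
      (y, (A.trivP α).toOpenPartialHomeomorph.symm (x, h)) :=
  (A.chi i).lift_lift_symm hy _

theorem smul_mem_chart_source {α : κ} {i : ι} {q : B.Pplus.Tot} (hq : q ∈ (A.chart α i).source)
    (g : G) : MulOpposite.op g • q ∈ (A.chart α i).source := by
  rw [mem_chart_source, B.Pplus.proj_action]; exact A.mem_chart_source.1 hq

theorem chart_smul {α : κ} {i : ι} {q : B.Pplus.Tot} (hq : q ∈ (A.chart α i).source) (g : G) :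
    A.chart α i (MulOpposite.op g • q) =
      ((A.chart α i q).1, ((A.chart α i q).2.1, (A.chart α i q).2.2 * g)) := by
  have h := A.mem_chart_source.1 hq
  have hl := (A.chi i).mem_lift_source.2 h.1
  rw [A.chart_apply (A.smul_mem_chart_source hq g), A.chart_apply hq, B.Pplus.proj_action,
    (A.chi i).lift_action q hl, (A.principal_trivP α).2 _
      (A.mem_trivP_source.2 (by rw [(A.chi i).proj_lift q hl]; exact h.2))]

theorem smul_phiTot {α : κ} {i : ι} {y : R} {x : M} (hy : y ∈ V i) (hx : x ∈ U α) (h g : G) :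
    MulOpposite.op g • A.phiTot α i x y h = A.phiTot α i x y (h * g) := by
  have hq := A.phiTot_mem_source hy hx h
  refine (A.chart α i).injOn (A.smul_mem_chart_source hq g) (A.phiTot_mem_source hy hx _) ?_
  rw [A.chart_smul hq, A.chart_phiTot hy hx, A.chart_phiTot hy hx]

theorem phiTot_eq_smul {α : κ} {i : ι} {y : R} {x : M} (hy : y ∈ V i) (hx : x ∈ U α) (h : G) :
    A.phiTot α i x y h = MulOpposite.op h • A.phiTot α i x y 1 := by
  rw [A.smul_phiTot hy hx, one_mul]

theorem exists_mem_chart_source (hU : IsOpenCoverFamily U) (hV : IsOpenCoverFamily V)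
    (q : B.Pplus.Tot) : ∃ a : κ × ι, q ∈ (A.chart a.1 a.2).source := by
  obtain ⟨i, hi⟩ := hV.2 (B.projS (B.Pplus.proj q))
  obtain ⟨α, hα⟩ := hU.2 ((A.chi i).base (B.Pplus.proj q)).2
  exact ⟨(α, i), A.mem_chart_source.2 ⟨hi, hα⟩⟩

end CompositeAtlas

namespace CompositeLocalData

variable {U : κ → Set M} {V : ι → Set R} (D : CompositeLocalData G U V)

/-- An injective idempotent map is the identity; `g_self` is the analogue for an idempotent of a
group. -/
theorem φ_self {i : ι} {y : R} (hy : y ∈ V i) (x : M) : D.φ i i y x = x :=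
  (D.φ i i y).injective (D.φ_comp i i i y ⟨⟨hy, hy⟩, hy⟩ x)

theorem φ_φ_symm {i j : ι} {y : R} (hi : y ∈ V i) (hj : y ∈ V j) (x : M) :
    D.φ j i y (D.φ i j y x) = x := by
  rw [D.φ_comp i j i y ⟨⟨hi, hj⟩, hi⟩, D.φ_self hi]

theorem g_self {α : κ} {i : ι} {y : R} {x : M} (hy : y ∈ V i) (hx : x ∈ U α) :
    D.g α i α i x y = 1 := by
  have h := D.twisted_cocycle α i α i α i y ⟨⟨hy, hy⟩, hy⟩ x hx (by rwa [D.φ_self hy])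
    (by rwa [D.φ_self hy])
  rw [D.φ_self hy] at h
  exact mul_eq_left.1 h

theorem g_mul_g_symm {α β : κ} {i j : ι} {y : R} {x : M} (hi : y ∈ V i) (hj : y ∈ V j)
    (hx : x ∈ U α) (hx' : D.φ i j y x ∈ U β) :
    D.g α i β j x y * D.g β j α i (D.φ i j y x) y = 1 := by
  rw [D.twisted_cocycle α i β j α i y ⟨⟨hi, hj⟩, hi⟩ x hx hx' (by rwa [D.φ_self hi]),
    D.g_self hi hx]

end CompositeLocalData

namespace CompositeAtlas.HasLocalData

variable {B : PrincipalCompositeBundle R M G} {U : κ → Set M} {V : ι → Set R}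
  {A : CompositeAtlas B U V} {D : CompositeLocalData G U V}

theorem base_chiInv (hA : A.HasLocalData D) {i j : ι} {y : R} (hi : y ∈ V i) (hj : y ∈ V j) (x : M) :
    (A.chi j).base (A.chiInv i y x) = (y, D.φ i j y x) := by
  rw [(A.chi j).base_apply (by rwa [A.projS_chiInv hi]), A.projS_chiInv hi,
    ← hA.torsion_eq i j y ⟨hi, hj⟩]
  rfl

theorem base_eq (hA : A.HasLocalData D) {i j : ι} {s : B.S} (hi : B.projS s ∈ V i) (hj : B.projS s ∈ V j) :
    ((A.chi j).base s).2 = D.φ i j (B.projS s) ((A.chi i).base s).2 := by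
  conv_lhs => rw [← A.chiInv_base hi]
  rw [hA.base_chiInv hi hj]

theorem chiInv_eq (hA : A.HasLocalData D) {i j : ι} {y : R} (hi : y ∈ V i) (hj : y ∈ V j) (x : M) :
    A.chiInv j y (D.φ i j y x) = A.chiInv i y x := by
  have h := A.chiInv_base (i := j) (s := A.chiInv i y x) (by rwa [A.projS_chiInv hi])
  rwa [hA.base_chiInv hi hj, A.projS_chiInv hi] at h

/-- The data prescribe this for h = 1 only; right translation gives the other h. -/
theorem phiTot_eq (hA : A.HasLocalData D) {α β : κ} {i j : ι} {y : R} {x : M} (hi : y ∈ V i) (hj : y ∈ V j)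
    (hx : x ∈ U α) (hx' : D.φ i j y x ∈ U β) (h : G) :
    A.phiTot β j (D.φ i j y x) y h = A.phiTot α i x y (D.g α i β j x y * h) := by
  rw [A.phiTot_eq_smul hj hx', hA.transition_eq α i β j y ⟨hi, hj⟩ x hx hx',
    A.smul_phiTot hi hx]

/-- For i = j there is no torsion, and applying the lift of χ^i leaves an identity in P: the
g^{(αi)(βi)} are the transition functions of the structure bundle. -/
theorem trivP_symm_eq (hA : A.HasLocalData D) {α β : κ} {i : ι} {y : R} {x : M} (hi : y ∈ V i) (hx : x ∈ U α)
    (hx' : x ∈ U β) (h : G) :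
    (A.trivP β).toOpenPartialHomeomorph.symm (x, h) =
      (A.trivP α).toOpenPartialHomeomorph.symm (x, D.g α i β i x y * h) := by
  have h1 := hA.phiTot_eq (β := β) hi hi hx (by rwa [D.φ_self hi]) h
  rw [D.φ_self hi] at h1
  have h2 := A.lift_phiTot (α := β) hi x h
  rw [h1, A.lift_phiTot hi] at h2
  exact (congrArg Prod.snd h2).symm

end CompositeAtlas.HasLocalData

end

/-! ### From an atlas to local data -/

section

variable {R M G : SmoothManifold.{u}} [Group G] [LieGroup G.I ∞ G] {ι κ : Type u}

namespace CompositeAtlas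

variable {B : PrincipalCompositeBundle R M G} {U : κ → Set M} {V : ι → Set R}
  (A : CompositeAtlas B U V)

theorem chiInv_torsion {i j : ι} {y : R} (hi : y ∈ V i) (hj : y ∈ V j) (x : M) :
    A.chiInv j y (A.torsion i j y x) = A.chiInv i y x := by
  have h := A.chiInv_base (i := j) (s := A.chiInv i y x) (by rwa [A.projS_chiInv hi])
  rwa [A.projS_chiInv hi] at h

theorem torsion_torsion {i j : ι} (k : ι) {y : R} (hi : y ∈ V i) (hj : y ∈ V j) (x : M) :
    A.torsion j k y (A.torsion i j y x) = A.torsion i k y x := by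
  rw [torsion, A.chiInv_torsion hi hj, torsion]

theorem torsion_self {i : ι} {y : R} (hi : y ∈ V i) (x : M) : A.torsion i i y x = x := by
  rw [torsion, A.base_chiInv hi]

theorem contMDiffOn_torsion (i j : ι) : ContMDiffOn (R.I.prod M.I) M.I ∞
    (fun p : R × M => A.torsion i j p.1 p.2) ((V i ∩ V j) ×ˢ Set.univ) := by
  refine contMDiff_snd.comp_contMDiffOn ((A.chi j).smooth_base.1.comp
    ((A.chi i).smooth_base.2.mono ?_) ?_)
  · exact fun p hp => (A.chi i).mem_base_target.2 hp.1.1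
  · rintro ⟨y, x⟩ hp
    refine (A.chi j).mem_base_source.2 ?_
    change B.projS (A.chiInv i y x) ∈ V j
    rw [A.projS_chiInv hp.1.1]
    exact hp.1.2

open Classical in
/-- The torsion functions as diffeomorphisms. -/
noncomputable def torsionDiffeo (i j : ι) (y : R) : M ≃ₘ⟮M.I, M.I⟯ M :=
  if h : y ∈ V i ∩ V j then
    { toFun := A.torsion i j y
      invFun := A.torsion j i y
      left_inv := fun x => by rw [A.torsion_torsion i h.1 h.2, A.torsion_self h.1]
      right_inv := fun x => by rw [A.torsion_torsion j h.2 h.1, A.torsion_self h.2]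
      contMDiff_toFun := contMDiffOn_univ.1 ((A.contMDiffOn_torsion i j).comp
        (contMDiff_const.prodMk contMDiff_id).contMDiffOn fun _ _ => ⟨h, trivial⟩)
      contMDiff_invFun := contMDiffOn_univ.1 ((A.contMDiffOn_torsion j i).comp
        (contMDiff_const.prodMk contMDiff_id).contMDiffOn fun _ _ => ⟨h.symm, trivial⟩) }
  -- An arbitrary value: local data are constrained only at y ∈ V i ∩ V j.
  else Diffeomorph.refl M.I M ∞

theorem torsionDiffeo_apply {i j : ι} {y : R} (h : y ∈ V i ∩ V j) (x : M) :
    A.torsionDiffeo i j y x = A.torsion i j y x := by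
  rw [torsionDiffeo, dif_pos h]; rfl

/-- The transition functions of the total twisted bundle. -/
noncomputable def transition (α : κ) (i : ι) (β : κ) (j : ι) (x : M) (y : R) : G :=
  (A.chart α i (A.phiTot β j (A.torsion i j y x) y 1)).2.2

theorem phiTot_torsion_mem_source {α β : κ} {i j : ι} {y : R} {x : M} (hi : y ∈ V i)
    (hj : y ∈ V j) (hx : x ∈ U α) (hx' : A.torsion i j y x ∈ U β) :
    A.phiTot β j (A.torsion i j y x) y 1 ∈ (A.chart α i).source := by
  rw [mem_chart_source, A.proj_phiTot hj hx', A.chiInv_torsion hi hj, A.projS_chiInv hi,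
    A.base_chiInv hi]
  exact ⟨hi, hx⟩

theorem phiTot_torsion {α β : κ} {i j : ι} {y : R} {x : M} (hi : y ∈ V i)
    (hj : y ∈ V j) (hx : x ∈ U α) (hx' : A.torsion i j y x ∈ U β) :
    A.phiTot β j (A.torsion i j y x) y 1 = A.phiTot α i x y (A.transition α i β j x y) := by
  have hq := A.phiTot_torsion_mem_source hi hj hx hx'
  have h := (A.chart α i).left_inv hq
  rw [← Prod.mk.eta (p := A.chart α i _), ← Prod.mk.eta (p := (A.chart α i _).2),
    chart_symm_apply, A.chart_apply hq, A.proj_phiTot hj hx', A.chiInv_torsion hi hj,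
    A.projS_chiInv hi, A.base_chiInv hi] at h
  exact h.symm

theorem exists_hasLocalData : ∃ D : CompositeLocalData G U V, A.HasLocalData D := by
  refine ⟨{
    φ := A.torsionDiffeo
    contMDiffOn_φ := fun i j => (A.contMDiffOn_torsion i j).congr fun p hp =>
      A.torsionDiffeo_apply hp.1 p.2
    φ_comp := ?_
    g := A.transition
    contMDiffOn_g := ?_
    g_independent := ?_
    twisted_cocycle := ?_ }, fun i j y hy x => (A.torsionDiffeo_apply hy x).symm, ?_⟩
  · intro i j k y hy x
    rw [A.torsionDiffeo_apply hy.1, A.torsionDiffeo_apply ⟨hy.1.2, hy.2⟩,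
      A.torsionDiffeo_apply ⟨hy.1.1, hy.2⟩, A.torsion_torsion k hy.1.1 hy.1.2]
  · intro α i β j
    have h1 : ∀ p ∈ twistedOverlap U V (fun i j y x => A.torsionDiffeo i j y x) α i β j,
        A.torsion i j p.2 p.1 ∈ U β := fun p hp => by
      rw [← A.torsionDiffeo_apply ⟨hp.1, hp.2.1⟩]; exact hp.2.2.2
    refine contMDiff_snd.comp_contMDiffOn (contMDiff_snd.comp_contMDiffOn
      ((A.isSmooth_chart α i).1.comp
        ((A.isSmooth_chart β j).2.comp (f := fun p : M × R => (p.2, (A.torsion i j p.2 p.1, 1)))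
          ?_ ?_) ?_))
    · refine contMDiffOn_snd.prodMk (ContMDiffOn.prodMk ?_ contMDiffOn_const)
      exact (A.contMDiffOn_torsion i j).comp (contMDiffOn_snd.prodMk contMDiffOn_fst)
        fun p hp => ⟨⟨hp.1, hp.2.1⟩, trivial⟩
    · exact fun p hp => A.mem_chart_target.2 ⟨hp.2.1, h1 p hp⟩
    · exact fun p hp => A.phiTot_torsion_mem_source hp.1 hp.2.1 hp.2.2.1 (h1 p hp)
  -- The torsion from i to i is trivial and χ^i cancels χ^{i*}; neither i nor y is left on the
  -- right-hand side.
  · have key : ∀ α β, ∀ x, ∀ i, ∀ y ∈ V i, A.transition α i β i x y =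
        (A.trivP α ((A.trivP β).toOpenPartialHomeomorph.symm (x, 1))).2 := by
      intro α β x i y hy
      change (A.trivP α ((A.chi i).lift _).2).2 = _
      rw [A.torsion_self hy, A.lift_phiTot hy]
    intro α β x hx i y hy i' y' hy'
    rw [key α β x i y hy, key α β x i' y' hy']
  · intro α i β j γ k y hy x hx hx' hx''
    have hij : y ∈ V i ∩ V j := hy.1
    have hik : y ∈ V i ∩ V k := ⟨hy.1.1, hy.2⟩
    rw [A.torsionDiffeo_apply hij] at hx' ⊢
    rw [A.torsionDiffeo_apply hik] at hx''
    -- One point of P₊ is expressed in the chart (αi) directly from (γk) and also by way of (βj);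
    -- its G-coordinates are the two sides of the relation.
    have h1 := A.phiTot_torsion hik.1 hik.2 hx hx''
    have h2 := A.phiTot_torsion (i := j) (x := A.torsion i j y x) (β := γ) hij.2 hik.2 hx'
      (by rwa [A.torsion_torsion k hij.1 hij.2])
    rw [A.torsion_torsion k hij.1 hij.2, h1, A.phiTot_eq_smul hij.2 hx',
      A.phiTot_torsion hij.1 hij.2 hx hx', A.smul_phiTot hij.1 hx] at h2
    have h3 := congrArg (A.chart α i) h2
    rw [A.chart_phiTot hij.1 hx, A.chart_phiTot hij.1 hx] at h3
    exact (congrArg (fun p => p.2.2) h3).symm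
  · intro α i β j y hy x hx hx'
    change A.torsionDiffeo i j y x ∈ U β at hx'
    change A.phiTot β j (A.torsionDiffeo i j y x) y 1 = _
    rw [A.torsionDiffeo_apply hy] at hx' ⊢
    exact A.phiTot_torsion hy.1 hy.2 hx hx'

end CompositeAtlas

end

/-! ### Existence and uniqueness of the isomorphism -/

section

variable {R M G : SmoothManifold.{u}} [Group G] [LieGroup G.I ∞ G] {ι κ : Type u}
  {B B' : PrincipalCompositeBundle R M G} {U : κ → Set M} {V : ι → Set R}
  {A : CompositeAtlas B U V} {A' : CompositeAtlas B' U V} {D : CompositeLocalData G U V}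

namespace CompositeAtlas.HasLocalData

/-- Transition functions of P occur in the data only as g^{(αi)(βi)}(x,y) with y ∈ V i, so a point
of R is needed to read them off. -/
theorem trivP_compat (hA : A.HasLocalData D) (hA' : A'.HasLocalData D) [Nonempty R]
    (hV : IsOpenCoverFamily V) (α β : κ) (p : B.P.Tot) (hα : p ∈ (A.trivP α).source)
    (hβ : p ∈ (A.trivP β).source) :
    (A'.trivP α).toOpenPartialHomeomorph.symm (A.trivP α p) =
      (A'.trivP β).toOpenPartialHomeomorph.symm (A.trivP β p) := by
  obtain ⟨y⟩ := ‹Nonempty R›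
  obtain ⟨i, hi⟩ := hV.2 y
  have hxα := A.mem_trivP_source.1 hα
  have hxβ := A.mem_trivP_source.1 hβ
  have h1 := (A.trivP β).symm_apply_mk_proj hβ
  rw [hA.trivP_symm_eq hi hxα hxβ] at h1
  have h2 := congrArg (A.trivP α) h1
  rw [(A.trivP α).apply_symm_apply' (by rwa [A.baseSet_trivP])] at h2
  rw [← h2, ← hA'.trivP_symm_eq hi hxα hxβ, (A.trivP β).mk_proj_snd hβ]

theorem base_compat (hA : A.HasLocalData D) (hA' : A'.HasLocalData D) (i j : ι) (s : B.S)
    (hi : s ∈ (A.chi i).base.source) (hj : s ∈ (A.chi j).base.source) :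
    (A'.chi i).base.toOpenPartialHomeomorph.symm ((A.chi i).base s) =
      (A'.chi j).base.toOpenPartialHomeomorph.symm ((A.chi j).base s) := by
  have hi' := (A.chi i).mem_base_source.1 hi
  have hj' := (A.chi j).mem_base_source.1 hj
  rw [(A.chi i).base_apply hi', (A.chi j).base_apply hj', hA.base_eq hi' hj']
  exact (hA'.chiInv_eq hi' hj' _).symm

theorem chart_compat (hA : A.HasLocalData D) (hA' : A'.HasLocalData D) (a b : κ × ι)
    (q : B.Pplus.Tot) (ha : q ∈ (A.chart a.1 a.2).source) (hb : q ∈ (A.chart b.1 b.2).source) :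
    (A'.chart a.1 a.2).symm (A.chart a.1 a.2 q) =
      (A'.chart b.1 b.2).symm (A.chart b.1 b.2 q) := by
  obtain ⟨hi, hx⟩ := A.mem_chart_source.1 ha
  obtain ⟨hj, hx'⟩ := A.mem_chart_source.1 hb
  obtain ⟨h, hq⟩ := A.exists_eq_phiTot hb
  have hbq := congrArg (A.chart b.1 b.2) hq
  rw [A.chart_phiTot hj hx'] at hbq
  rw [hA.base_eq hi hj] at hx' hbq hq
  rw [hA.phiTot_eq hi hj hx hx'] at hq
  have haq := congrArg (A.chart a.1 a.2) hq
  rw [A.chart_phiTot hi hx] at haq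
  rw [haq, hbq, chart_symm_apply, chart_symm_apply, hA'.phiTot_eq hi hj hx hx']

theorem exists_iso (hA : A.HasLocalData D) (hA' : A'.HasLocalData D) [Nonempty R]
    (hU : IsOpenCoverFamily U) (hV : IsOpenCoverFamily V) :
    ∃ F : CompositeIso B B', F.Preserves A A' := by
  obtain ⟨onP, honP⟩ := OpenPartialHomeomorph.exists_diffeomorph_of_charts
    (I := B.P.Tot.I) (I' := B'.P.Tot.I) (J := M.I.prod G.I)
    (fun α => (A.trivP α).toOpenPartialHomeomorph) (fun α => (A'.trivP α).toOpenPartialHomeomorph)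
    (fun α => (A.principal_trivP α).1) (fun α => (A'.principal_trivP α).1)
    (fun p => (hU.2 (B.P.proj p)).imp fun α h => A.mem_trivP_source.2 h)
    (fun p => (hU.2 (B'.P.proj p)).imp fun α h => A'.mem_trivP_source.2 h)
    (fun α => by
      rw [(A.trivP α).target_eq, (A'.trivP α).target_eq, A.baseSet_trivP, A'.baseSet_trivP])
    (hA.trivP_compat hA' hV) (hA'.trivP_compat hA hV)
  obtain ⟨onS, honS⟩ := OpenPartialHomeomorph.exists_diffeomorph_of_charts
    (I := B.S.I) (I' := B'.S.I) (J := R.I.prod M.I)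
    (fun i => (A.chi i).base.toOpenPartialHomeomorph)
    (fun i => (A'.chi i).base.toOpenPartialHomeomorph)
    (fun i => (A.chi i).smooth_base) (fun i => (A'.chi i).smooth_base)
    (fun s => (hV.2 (B.projS s)).imp fun i h => (A.chi i).mem_base_source.2 h)
    (fun s => (hV.2 (B'.projS s)).imp fun i h => (A'.chi i).mem_base_source.2 h)
    (fun i => by
      rw [(A.chi i).base.target_eq, (A'.chi i).base.target_eq, (A.chi i).baseSet_base,
        (A'.chi i).baseSet_base])
    (hA.base_compat hA') (hA'.base_compat hA)
  obtain ⟨onQ, honQ⟩ := OpenPartialHomeomorph.exists_diffeomorph_of_charts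
    (I := B.Pplus.Tot.I) (I' := B'.Pplus.Tot.I) (J := R.I.prod (M.I.prod G.I))
    (fun a : κ × ι => A.chart a.1 a.2) (fun a : κ × ι => A'.chart a.1 a.2)
    (fun a => A.isSmooth_chart _ _) (fun a => A'.isSmooth_chart _ _)
    (A.exists_mem_chart_source hU hV) (A'.exists_mem_chart_source hU hV)
    (fun a => by ext p; rw [A.mem_chart_target, A'.mem_chart_target])
    (hA.chart_compat hA') (hA'.chart_compat hA)
  refine ⟨{
    onP := onP
    onS := onS
    onPplus := onQ
    proj_onP := ?_
    projS_onS := ?_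
    proj_onPplus := ?_
    onP_action := ?_
    onPplus_action := ?_ }, fun α p hp => (honP α p hp).2, fun i s hs => (honS i s hs).2, ?_⟩
  · intro p
    obtain ⟨α, hα⟩ := hU.2 (B.P.proj p)
    have hp := A.mem_trivP_source.2 hα
    obtain ⟨h1, h2⟩ := honP α p hp
    rw [← (A'.trivP α).coe_fst h1, ← (A.trivP α).coe_fst hp]
    exact congrArg Prod.fst h2
  · intro s
    obtain ⟨i, hi⟩ := hV.2 (B.projS s)
    have hs := (A.chi i).mem_base_source.2 hi
    obtain ⟨h1, h2⟩ := honS i s hs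
    rw [← (A'.chi i).base.coe_fst h1, ← (A.chi i).base.coe_fst hs]
    exact congrArg Prod.fst h2
  · intro q
    obtain ⟨⟨α, i⟩, hq⟩ := A.exists_mem_chart_source hU hV q
    obtain ⟨h1, h2⟩ := honQ ⟨α, i⟩ q hq
    have hi := (A.mem_chart_source.1 hq).1
    have hi' := (A'.mem_chart_source.1 h1).1
    obtain ⟨h3, h4⟩ := honS i (B.Pplus.proj q) ((A.chi i).mem_base_source.2 hi)
    -- Both points are compared in the chart χ^i of the second bundle, where their coordinates are
    -- the R- and M-coordinates of q.
    refine (A'.chi i).base.injOn ((A'.chi i).mem_base_source.2 hi') h3 (Eq.trans ?_ h4.symm)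
    change (A'.chi i).base _ = (A.chi i).base _
    change A'.chart α i _ = A.chart α i q at h2
    rw [A'.chart_apply h1, A.chart_apply hq] at h2
    rw [(A'.chi i).base_apply hi', (A.chi i).base_apply hi]
    have h7 := congrArg Prod.fst h2
    have h8 := congrArg (fun p => p.2.1) h2
    exact Prod.ext h7 h8
  · intro p g
    obtain ⟨α, hα⟩ := hU.2 (B.P.proj p)
    have hp := A.mem_trivP_source.2 hα
    have hpg : MulOpposite.op g • p ∈ (A.trivP α).source :=
      A.mem_trivP_source.2 (by rwa [B.P.proj_action])
    obtain ⟨h1, h2⟩ := honP α p hp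
    obtain ⟨h3, h4⟩ := honP α _ hpg
    have h5 : MulOpposite.op g • onP p ∈ (A'.trivP α).source :=
      A'.mem_trivP_source.2 (by rw [B'.P.proj_action]; exact A'.mem_trivP_source.1 h1)
    change A'.trivP α _ = A.trivP α _ at h2 h4
    refine (A'.trivP α).injOn h3 h5 (h4.trans (Prod.ext ?_ ?_))
    · change _ = (A'.trivP α _).1
      rw [(A.trivP α).coe_fst hpg, (A'.trivP α).coe_fst h5, B'.P.proj_action, B.P.proj_action,
        ← (A'.trivP α).coe_fst h1, h2, (A.trivP α).coe_fst hp]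
    · change _ = (A'.trivP α _).2
      rw [(A.principal_trivP α).2 p hp, (A'.principal_trivP α).2 _ h1, h2]
  · intro q g
    obtain ⟨⟨α, i⟩, hq⟩ := A.exists_mem_chart_source hU hV q
    obtain ⟨h1, h2⟩ := honQ ⟨α, i⟩ q hq
    obtain ⟨h3, h4⟩ := honQ ⟨α, i⟩ _ (A.smul_mem_chart_source hq g)
    refine (A'.chart α i).injOn h3 (A'.smul_mem_chart_source h1 g) (h4.trans ?_)
    rw [A.chart_smul hq, A'.chart_smul h1, h2]
  -- The G-coordinate of `chart` is that of φ_P^α applied to the lift, so the claim follows by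
  -- injectivity of the trivialisation of the second structure bundle.
  · intro i q hq
    have hi := (A.chi i).mem_lift_source.1 hq
    obtain ⟨α, hα⟩ := hU.2 ((A.chi i).base (B.Pplus.proj q)).2
    have hq' := A.mem_chart_source.2 ⟨hi, hα⟩
    obtain ⟨h1, h2⟩ := honQ ⟨α, i⟩ q hq'
    have hl : ((A.chi i).lift q).2 ∈ (A.trivP α).source :=
      A.mem_trivP_source.2 (by rw [(A.chi i).proj_lift q hq]; exact hα)
    obtain ⟨h3, h4⟩ := honP α _ hl
    obtain ⟨h5, h6⟩ := A'.mem_chart_source.1 h1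
    refine (A'.trivP α).injOn (A'.mem_trivP_source.2 ?_) h3 ((congrArg Prod.snd h2).trans h4.symm)
    rw [(A'.chi i).proj_lift _ ((A'.chi i).mem_lift_source.2 h5)]
    exact h6

end CompositeAtlas.HasLocalData

/-- The charts force `onP` and `onS`; the lifts then force `onPplus`, because they take values in R
× P and `onP` is already known. -/
theorem CompositeIso.Preserves.unique {F F' : CompositeIso B B'} (hF : F.Preserves A A')
    (hF' : F'.Preserves A A') (hU : IsOpenCoverFamily U) (hV : IsOpenCoverFamily V) : F = F' := by
  have hP : F.onP = F'.onP := by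
    ext p
    obtain ⟨α, hα⟩ := hU.2 (B.P.proj p)
    have hp := A.mem_trivP_source.2 hα
    refine (A'.trivP α).injOn (A'.mem_trivP_source.2 (by rwa [F.proj_onP]))
      (A'.mem_trivP_source.2 (by rwa [F'.proj_onP])) ?_
    exact (hF.trivP α p hp).trans (hF'.trivP α p hp).symm
  have hS : F.onS = F'.onS := by
    ext s
    obtain ⟨i, hi⟩ := hV.2 (B.projS s)
    have hs := (A.chi i).mem_base_source.2 hi
    refine (A'.chi i).base.injOn ((A'.chi i).mem_base_source.2 (by rwa [F.projS_onS]))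
      ((A'.chi i).mem_base_source.2 (by rwa [F'.projS_onS])) ?_
    exact (hF.base i s hs).trans (hF'.base i s hs).symm
  refine CompositeIso.ext hP hS ?_
  ext q
  obtain ⟨i, hi⟩ := hV.2 (B.projS (B.Pplus.proj q))
  have hq := (A.chi i).mem_lift_source.2 hi
  have h1 : B'.projS (B'.Pplus.proj (F.onPplus q)) = B.projS (B.Pplus.proj q) := by
    rw [F.proj_onPplus, F.projS_onS]
  have h2 : B'.projS (B'.Pplus.proj (F'.onPplus q)) = B.projS (B.Pplus.proj q) := by
    rw [F'.proj_onPplus, F'.projS_onS]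
  refine (A'.chi i).lift.injOn ((A'.chi i).mem_lift_source.2 (by rwa [h1]))
    ((A'.chi i).mem_lift_source.2 (by rwa [h2])) ?_
  have h3 := (A'.chi i).lift_apply (q := F.onPplus q) (by rwa [h1])
  have h4 := (A'.chi i).lift_apply (q := F'.onPplus q) (by rwa [h2])
  refine h3.trans (Eq.trans ?_ h4.symm)
  rw [h1, h2, hF.lift i q hq, hF'.lift i q hq, hP]

end

/-! ### The glued spaces -/

/-- The quotient of a space by the kernel of a continuous open surjection is its image. -/
theorem Quot.exists_homeomorph {X Y : Type*} [TopologicalSpace X] [TopologicalSpace Y]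
    {r : X → X → Prop} {f : X → Y} (hf : Continuous f) (ho : IsOpenMap f)
    (hs : Function.Surjective f) (hr : ∀ a b, r a b ↔ f a = f b) :
    ∃ e : Quot r ≃ₜ Y, ∀ x, e (Quot.mk r x) = f x := by
  let F : Quot r → Y := Quot.lift f fun a b h => (hr a b).1 h
  have hF : Function.Bijective F := by
    refine ⟨fun a b h => ?_, fun y => (hs y).imp' (Quot.mk r) fun _ h => h⟩
    induction a using Quot.ind
    induction b using Quot.ind
    exact Quot.sound ((hr _ _).2 h)
  refine ⟨(Equiv.ofBijective F hF).toHomeomorphOfContinuousOpen (continuous_quot_lift _ hf) ?_,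
    fun x => rfl⟩
  intro O hO
  have h1 : (Equiv.ofBijective F hF) '' O = f '' (Quot.mk r ⁻¹' O) := by
    ext y
    constructor
    · rintro ⟨a, ha, rfl⟩
      induction a using Quot.ind
      exact ⟨_, ha, rfl⟩
    · rintro ⟨x, hx, rfl⟩
      exact ⟨_, hx, rfl⟩
  rw [h1]
  exact ho _ (hO.preimage continuous_quot_mk)

/-- An open map into the source of an open partial homeomorphism stays open after composition. -/
theorem OpenPartialHomeomorph.isOpenMap_comp {X Y Z : Type*} [TopologicalSpace X]
    [TopologicalSpace Y] [TopologicalSpace Z] (e : OpenPartialHomeomorph Y Z) {f : X → Y}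
    (hf : IsOpenMap f) (h : ∀ x, f x ∈ e.source) : IsOpenMap fun x => e (f x) := fun O hO => by
  rw [← Function.comp_def, Set.image_comp]
  exact e.isOpen_image_of_subset_source (hf O hO) (Set.image_subset_iff.2 fun x _ => h x)

section

variable {R M G : SmoothManifold.{u}} [Group G] [LieGroup G.I ∞ G] {ι κ : Type u}
  {U : κ → Set M} {V : ι → Set R}

namespace CompositeLocalData

variable (D : CompositeLocalData G U V)

theorem baseRel_equivalence : Equivalence D.baseRel := by
  refine ⟨?_, ?_, ?_⟩
  · rintro ⟨i, y, x⟩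
    exact ⟨rfl, (D.φ_self y.2 x).symm⟩
  · rintro ⟨i, ⟨y, hy⟩, x⟩ ⟨j, ⟨y', hy'⟩, x'⟩ ⟨h1, h2⟩
    dsimp only at h1 h2
    subst h1 h2
    exact ⟨rfl, (D.φ_φ_symm hy hy' x).symm⟩
  · rintro ⟨i, ⟨y, hy⟩, x⟩ ⟨j, ⟨y', hy'⟩, x'⟩ ⟨k, ⟨y'', hy''⟩, x''⟩ ⟨h1, h2⟩ ⟨h3, h4⟩
    dsimp only at h1 h2 h3 h4
    subst h1 h2 h3 h4
    exact ⟨rfl, D.φ_comp i j k y ⟨⟨hy, hy'⟩, hy''⟩ x⟩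

theorem mk_eq_mk {i j : ι} {y : V i} {y' : V j} {x x' : M} :
    Quot.mk D.baseRel ⟨i, y, x⟩ = Quot.mk D.baseRel ⟨j, y', x'⟩ ↔
      (y : R) = y' ∧ x' = D.φ i j y x := by
  rw [Quot.eq, D.baseRel_equivalence.eqvGen_iff]
  rfl

theorem mk_φ {i j : ι} {y : V i} (hy : (y : R) ∈ V j) (x : M) :
    Quot.mk D.baseRel ⟨j, ⟨y, hy⟩, D.φ i j y x⟩ = Quot.mk D.baseRel ⟨i, y, x⟩ :=
  D.mk_eq_mk.2 ⟨rfl, (D.φ_φ_symm y.2 hy x).symm⟩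

/-- The coordinates of s in a given piece are unique because φ^{ii}_y is the identity, so the
existential in `totalRel` may be tested on any known pair. -/
theorem totalRel_mk {a b : κ × ι} {y : V a.2} {x : M} (s : D.W a)
    (hs : Quot.mk D.baseRel ⟨a.2, y, x⟩ = (s : D.GluedBase)) (s' : D.W b) (h h' : G) :
    D.totalRel ⟨a, s, h⟩ ⟨b, s', h'⟩ ↔
      (s : D.GluedBase) = s' ∧ h = D.g a.1 a.2 b.1 b.2 x y * h' := by
  refine and_congr_right fun _ => ⟨?_, fun h => ⟨y, x, hs, h⟩⟩
  rintro ⟨y', x', hs', hh⟩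
  obtain ⟨h1, h2⟩ := D.mk_eq_mk.1 (hs'.trans hs.symm)
  rw [D.φ_self y'.2] at h2
  rw [h2, ← h1]
  exact hh

theorem mem_W {a : κ × ι} {i : ι} {y : V i} {x : M} :
    Quot.mk D.baseRel ⟨i, y, x⟩ ∈ D.W a ↔ (y : R) ∈ V a.2 ∧ D.φ i a.2 y x ∈ U a.1 := by
  constructor
  · rintro ⟨y', x', hx', h⟩
    obtain ⟨h1, h2⟩ := D.mk_eq_mk.1 h.symm
    rw [h1]
    refine ⟨y'.2, ?_⟩
    rwa [← h1, ← h2]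
  · rintro ⟨hy, hx⟩
    exact ⟨⟨y, hy⟩, _, hx, D.mk_φ hy x⟩

/-- The three properties are g = 1 on the diagonal, the inverse formula and the twisted cocycle
relation. The coordinates of s are moved by φ^{ij} whenever the first piece of the relation changes.
-/
theorem totalRel_equivalence : Equivalence D.totalRel := by
  refine ⟨?_, ?_, ?_⟩
  · rintro ⟨a, ⟨s, hs⟩, h⟩
    obtain ⟨y, x, hx, hs'⟩ := hs
    rw [D.totalRel_mk _ hs', D.g_self y.2 hx]
    exact ⟨rfl, (one_mul h).symm⟩
  · rintro ⟨a, ⟨s, hs⟩, h⟩ ⟨b, ⟨s', hs'⟩, h'⟩ hr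
    obtain rfl : s = s' := hr.1
    obtain ⟨y, x, hx, rfl⟩ := id hs
    obtain ⟨hy, hx'⟩ := D.mem_W.1 hs'
    rw [D.totalRel_mk _ rfl] at hr
    obtain ⟨-, rfl⟩ := hr
    rw [D.totalRel_mk _ (D.mk_φ hy x)]
    refine ⟨rfl, ?_⟩
    have h1 := D.g_mul_g_symm (α := b.1) (β := a.1) (x := D.φ a.2 b.2 y x) hy y.2 hx'
      (by rwa [D.φ_φ_symm y.2 hy])
    rw [D.φ_φ_symm y.2 hy] at h1
    rw [← mul_assoc, h1, one_mul]
  · rintro ⟨a, ⟨s, hs⟩, h⟩ ⟨b, ⟨s', hs'⟩, h'⟩ ⟨c, ⟨s'', hs''⟩, h''⟩ hr hr'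
    obtain rfl : s = s' := hr.1
    obtain rfl : s = s'' := hr'.1
    obtain ⟨y, x, hx, rfl⟩ := id hs
    obtain ⟨hy, hx'⟩ := D.mem_W.1 hs'
    obtain ⟨hy', hx''⟩ := D.mem_W.1 hs''
    rw [D.totalRel_mk _ rfl] at hr ⊢
    rw [D.totalRel_mk _ (D.mk_φ hy x)] at hr'
    refine ⟨rfl, ?_⟩
    rw [hr.2, hr'.2, ← mul_assoc, D.twisted_cocycle _ _ _ _ _ _ y ⟨⟨y.2, hy⟩, hy'⟩ x hx hx' hx'']

end CompositeLocalData

namespace CompositeAtlas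

variable {B : PrincipalCompositeBundle R M G} (A : CompositeAtlas B U V)

/-- The chart of `P₊` with values in `S × G`, inverse to `φ₊^{αi}`. -/
noncomputable def chartPlus (α : κ) (i : ι) : OpenPartialHomeomorph B.Pplus.Tot (B.S × G) :=
  (A.chart α i).trans ((Homeomorph.prodAssoc R M G).symm.toOpenPartialHomeomorph.trans
    ((A.chi i).base.toOpenPartialHomeomorph.symm.prod (OpenPartialHomeomorph.refl G)))

theorem mem_chartPlus_target {α : κ} {i : ι} {s : B.S} (hs : B.projS s ∈ V i)
    (hx : ((A.chi i).base s).2 ∈ U α) (h : G) : (s, h) ∈ (A.chartPlus α i).target := by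
  have h1 := (A.chi i).mem_base_source.2 hs
  have h2 := (A.chi i).base.map_source h1
  refine ⟨⟨⟨h1, trivial⟩, trivial⟩, A.mem_chart_target.2 ⟨?_, hx⟩⟩
  exact (A.chi i).mem_base_target.1 h2

theorem chartPlus_symm_apply {i : ι} (α : κ) {s : B.S} (hs : B.projS s ∈ V i) (h : G) :
    (A.chartPlus α i).symm (s, h) = A.phiPlus α i s h := by
  change A.phiTot α i ((A.chi i).base s).2 ((A.chi i).base s).1 h = _
  rw [(A.chi i).base_apply hs, phiPlus]

namespace HasLocalData

variable {A} {D : CompositeLocalData G U V}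

/-- On each piece the map is an inverse chart restricted to the open set V i × M, hence continuous
and open; its fibres are the classes because the torsion functions are those of `D`. -/
theorem exists_homeomorph_base (hA : A.HasLocalData D) (hV : IsOpenCoverFamily V) :
    ∃ e : D.GluedBase ≃ₜ B.S, ∀ (i : ι) (y : V i) (x : M),
      e (Quot.mk D.baseRel ⟨i, y, x⟩) = A.chiInv i y x := by
  have hcont : Continuous (fun a : Σ i, V i × M => A.chiInv a.1 a.2.1 a.2.2) := by
    refine continuous_sigma fun i => ?_
    exact (A.chi i).base.toOpenPartialHomeomorph.continuousOn_symm.comp_continuous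
      ((continuous_subtype_val.comp continuous_fst).prodMk continuous_snd)
      fun p => (A.chi i).mem_base_target.2 p.1.2
  refine (Quot.exists_homeomorph (r := D.baseRel) hcont ?_ ?_ ?_).imp fun e he i y x => he _
  · refine isOpenMap_sigma.2 fun i => ?_
    exact (A.chi i).base.toOpenPartialHomeomorph.symm.isOpenMap_comp
      (f := fun p : V i × M => ((p.1 : R), p.2))
      ((hV.1 i).isOpenMap_subtype_val.prodMap IsOpenMap.id)
      fun p => (A.chi i).mem_base_target.2 p.1.2
  · intro s
    obtain ⟨i, hi⟩ := hV.2 (B.projS s)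
    exact ⟨⟨i, ⟨_, hi⟩, _⟩, A.chiInv_base hi⟩
  · rintro ⟨i, ⟨y, hy⟩, x⟩ ⟨j, ⟨y', hy'⟩, x'⟩
    constructor
    · rintro ⟨h1, h2⟩
      dsimp only at h1 h2
      subst h1 h2
      exact (hA.chiInv_eq hy hy' x).symm
    · intro h
      have h1 : y = y' := by
        have := congrArg B.projS h
        rwa [A.projS_chiInv hy, A.projS_chiInv hy'] at this
      subst h1
      have h2 := congrArg (A.chi j).base h
      rw [hA.base_chiInv hy hy', A.base_chiInv hy'] at h2
      exact ⟨rfl, (congrArg Prod.snd h2).symm⟩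

theorem exists_homeomorph_total (hA : A.HasLocalData D) (hU : IsOpenCoverFamily U)
    (hV : IsOpenCoverFamily V) (e : D.GluedBase ≃ₜ B.S)
    (he : ∀ (i : ι) (y : V i) (x : M), e (Quot.mk D.baseRel ⟨i, y, x⟩) = A.chiInv i y x) :
    ∃ f : D.GluedTotal ≃ₜ B.Pplus.Tot, ∀ (a : κ × ι) (s : D.W a) (h : G),
      f (Quot.mk D.totalRel ⟨a, s, h⟩) = A.phiPlus a.1 a.2 (e s) h := by
  have hmem : ∀ (a : κ × ι) (s : D.GluedBase), s ∈ D.W a ↔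
      B.projS (e s) ∈ V a.2 ∧ ((A.chi a.2).base (e s)).2 ∈ U a.1 := by
    intro a s
    obtain ⟨⟨i, y, x⟩, rfl⟩ := Quot.exists_rep s
    rw [D.mem_W, he, A.projS_chiInv y.2]
    exact and_congr_right fun hy => by rw [hA.base_chiInv y.2 hy]
  have htar : ∀ (a : κ × ι) (p : D.W a × G),
      (e p.1, p.2) ∈ (A.chartPlus a.1 a.2).target := fun a p =>
    A.mem_chartPlus_target ((hmem a _).1 p.1.2).1 ((hmem a _).1 p.1.2).2 _
  have heq : ∀ (a : κ × ι) (p : D.W a × G), A.phiPlus a.1 a.2 (e p.1) p.2 =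
      (A.chartPlus a.1 a.2).symm (e p.1, p.2) := fun a p =>
    (A.chartPlus_symm_apply _ ((hmem a _).1 p.1.2).1 _).symm
  -- Openness of W^{αi} makes its inclusion an open map, which the openness of the map to P₊ rests
  -- on.
  have hopenW : ∀ a, IsOpen (D.W a) := by
    intro a
    have : D.W a = e ⁻¹' ((A.chi a.2).base.source ∩
        (A.chi a.2).base ⁻¹' (Prod.snd ⁻¹' U a.1)) := by
      ext s
      rw [hmem, Set.mem_preimage, Set.mem_inter_iff, (A.chi a.2).mem_base_source]
      rfl
    rw [this]
    exact ((A.chi a.2).base.isOpen_inter_preimage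
      ((hU.1 a.1).preimage continuous_snd)).preimage e.continuous
  have hcont : Continuous (fun a : Σ a : κ × ι, D.W a × G =>
      A.phiPlus a.1.1 a.1.2 (e a.2.1) a.2.2) := by
    refine continuous_sigma fun a => ?_
    simp only [heq]
    exact (A.chartPlus a.1 a.2).continuousOn_symm.comp_continuous
      ((e.continuous.comp (continuous_subtype_val.comp continuous_fst)).prodMk continuous_snd)
      (htar a)
  have hproj : ∀ (a : κ × ι) (s : D.W a) (h : G),
      B.Pplus.proj (A.phiPlus a.1 a.2 (e s) h) = e s := fun a s h => by
    have h1 := (hmem a _).1 s.2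
    rw [phiPlus, A.proj_phiTot h1.1 h1.2, A.chiInv_base h1.1]
  refine (Quot.exists_homeomorph (r := D.totalRel) hcont ?_ ?_ ?_).imp fun f hf a s h => hf _
  · refine isOpenMap_sigma.2 fun a => ?_
    simp only [heq]
    exact (A.chartPlus a.1 a.2).symm.isOpenMap_comp
      (f := fun p : D.W a × G => (e (p.1 : D.GluedBase), p.2))
      ((e.isOpenMap.comp (hopenW a).isOpenMap_subtype_val).prodMap IsOpenMap.id) (htar a)
  · intro q
    obtain ⟨a, ha⟩ := A.exists_mem_chart_source hU hV q
    obtain ⟨h, hq⟩ := A.exists_eq_phiTot ha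
    have hs : e.symm (B.Pplus.proj q) ∈ D.W a := by
      rw [hmem, e.apply_symm_apply]; exact A.mem_chart_source.1 ha
    refine ⟨⟨a, ⟨_, hs⟩, h⟩, ?_⟩
    dsimp only
    rw [e.apply_symm_apply]
    exact hq.symm
  · rintro ⟨a, s, h⟩ ⟨b, s', h'⟩
    obtain ⟨y, x, hx, hs⟩ := id s.2
    have hes : e s = A.chiInv a.2 y x := by rw [← hs, he]
    -- The value on the piece b is rewritten in the piece a; both directions of "related iff same
    -- image" then reduce to comparing G-coordinates.
    have key : (s : D.GluedBase) = s' → A.phiPlus b.1 b.2 (e s') h' =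
        A.phiPlus a.1 a.2 (e s) (D.g a.1 a.2 b.1 b.2 x y * h') := by
      intro hss
      have hs' := s'.2
      rw [← hss, ← hs] at hs'
      obtain ⟨hy, hx'⟩ := D.mem_W.1 hs'
      rw [← hss, phiPlus, phiPlus, hes, A.base_chiInv y.2, hA.base_chiInv y.2 hy,
        A.projS_chiInv y.2, hA.phiTot_eq y.2 hy hx hx']
    rw [D.totalRel_mk s hs]
    constructor
    · rintro ⟨hss, rfl⟩
      exact (key hss).symm
    · intro hq
      dsimp only at hq
      have hss : (s : D.GluedBase) = s' := by
        have := congrArg B.Pplus.proj hq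
        rw [hproj, hproj] at this
        exact e.injective this
      refine ⟨hss, ?_⟩
      rw [key hss, heq a (s, _), heq a (s, _)] at hq
      exact congrArg Prod.snd ((A.chartPlus a.1 a.2).symm.injOn (htar a (s, _)) (htar a (s, _)) hq)

end HasLocalData

end CompositeAtlas

end

/-! ### Restriction of trivialisations and good covers -/

namespace Bundle.Trivialization

variable {B F Z : Type*} [TopologicalSpace B] [TopologicalSpace F] [TopologicalSpace Z]
  {proj : Z → B} (e e' : Bundle.Trivialization F proj)

theorem symm_eq_symm_of_apply_eq {x : B} {v w : F} (hx : x ∈ e.baseSet) (hx' : x ∈ e'.baseSet)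
    (h : e' (e.toOpenPartialHomeomorph.symm (x, v)) = (x, w)) :
    e.toOpenPartialHomeomorph.symm (x, v) = e'.toOpenPartialHomeomorph.symm (x, w) := by
  rw [← h]
  refine (e'.left_inv ?_).symm
  change _ ∈ e'.source
  rwa [e'.mem_source, e.proj_symm_apply' hx]

theorem baseSet_restrOpen {s : Set B} (hs : IsOpen s) (h : s ⊆ e.baseSet) :
    (e.restrOpen s hs).baseSet = s :=
  Set.inter_eq_right.2 h

theorem source_restrOpen_subset {s : Set B} (hs : IsOpen s) :
    (e.restrOpen s hs).source ⊆ e.source := fun _ hz =>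
  e.mem_source.2 ((e.restrOpen s hs).mem_source.1 hz).1

theorem target_restrOpen_subset {s : Set B} (hs : IsOpen s) :
    (e.restrOpen s hs).target ⊆ e.target := fun _ hz =>
  e.mem_target.2 ((e.restrOpen s hs).mem_target.1 hz).1

end Bundle.Trivialization

theorem IsSmoothTrivialization.restrOpen {B F Z : SmoothManifold.{u}} {proj : Z → B}
    {e : Bundle.Trivialization F proj} (he : IsSmoothTrivialization e) {s : Set B}
    (hs : IsOpen s) : IsSmoothTrivialization (e.restrOpen s hs) :=
  ⟨he.1.mono (e.source_restrOpen_subset hs), he.2.mono (e.target_restrOpen_subset hs)⟩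

/-- Charts take values in a normed space, where balls are convex and so contractible; a small ball
is carried back to X. -/
theorem SmoothManifold.exists_contractible_nhd (X : SmoothManifold.{u}) {O : Set X}
    (hO : IsOpen O) {x : X} (hx : x ∈ O) :
    ∃ N : Set X, IsOpen N ∧ x ∈ N ∧ N ⊆ O ∧ ContractibleSpace N := by
  let c := chartAt X.model x
  have hxc : x ∈ c.source := mem_chart_source _ _
  obtain ⟨ε, hε, hball⟩ := Metric.isOpen_iff.1 (c.isOpen_inter_preimage_symm hO) (c x)
    ⟨c.map_source hxc, by rwa [Set.mem_preimage, c.left_inv hxc]⟩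
  have hsub : Metric.ball (c x) ε ⊆ c.symm.source := fun y hy => (hball hy).1
  refine ⟨c.symm '' Metric.ball (c x) ε,
    c.symm.isOpen_image_of_subset_source Metric.isOpen_ball hsub,
    ⟨c x, Metric.mem_ball_self hε, c.left_inv hxc⟩, ?_, ?_⟩
  · rintro _ ⟨y, hy, rfl⟩
    exact (hball hy).2
  · have : ContractibleSpace (Metric.ball (c x) ε) :=
      (convex_ball (c x) ε).contractibleSpace ⟨c x, Metric.mem_ball_self hε⟩
    exact (c.symm.homeomorphOfImageSubsetSource hsub rfl).symm.contractibleSpace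

section

variable {R M G : SmoothManifold.{u}} [Group G] [LieGroup G.I ∞ G] {ι κ : Type u}

/-- Restriction of the trivialisations of a tower to a smaller open set. -/
def CompositeTrivialization.restrict {P : PrincipalBundle M G} {S : SmoothManifold.{u}}
    {projS : S → R} {Pplus : PrincipalBundle S G} {V V' : Set R}
    (C : CompositeTrivialization P projS Pplus V) (hV' : IsOpen V') (h : V' ⊆ V) :
    CompositeTrivialization P projS Pplus V' where
  base := C.base.restrOpen V' hV'
  baseSet_base := C.base.baseSet_restrOpen hV' (by rwa [C.baseSet_base])
  smooth_base := C.smooth_base.restrOpen hV'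
  lift := C.lift.restrOpen V' hV'
  baseSet_lift := C.lift.baseSet_restrOpen hV' (by rwa [C.baseSet_lift])
  smooth_lift := C.smooth_lift.restrOpen hV'
  lift_action := fun p hp => C.lift_action p (C.lift.source_restrOpen_subset hV' hp)
  proj_lift := fun p hp => C.proj_lift p (C.lift.source_restrOpen_subset hV' hp)

/-- A trivialisation is chosen at every point and shrunk to a contractible neighbourhood; the points
of M and R themselves index the covers. -/
theorem PrincipalCompositeBundle.exists_good_atlas (B : PrincipalCompositeBundle R M G) :
    ∃ (κ ι : Type u) (U : κ → Set M) (V : ι → Set R),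
      IsGoodCover U ∧ IsGoodCover V ∧ Nonempty (CompositeAtlas B U V) := by
  choose e hxe he using B.P.locally_trivial
  choose V hyV hV using B.locally_trivial
  have C := fun y => (hV y).some
  have hVo : ∀ y, IsOpen (V y) := fun y => (C y).baseSet_base ▸ (C y).base.open_baseSet
  choose N hNo hxN hNe hNc using fun x => M.exists_contractible_nhd (e x).open_baseSet (hxe x)
  choose N' hNo' hyN' hNV' hNc' using fun y => R.exists_contractible_nhd (hVo y) (hyV y)
  exact ⟨M, R, N, N', ⟨⟨hNo, fun x => ⟨x, hxN x⟩⟩, hNc⟩, ⟨⟨hNo', fun y => ⟨y, hyN' y⟩⟩, hNc'⟩,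
    ⟨{
      trivP := fun x => (e x).restrOpen (N x) (hNo x)
      baseSet_trivP := fun x => (e x).baseSet_restrOpen (hNo x) (hNe x)
      principal_trivP := fun x => ⟨(he x).1.restrOpen (hNo x), fun p hp =>
        (he x).2 p ((e x).source_restrOpen_subset (hNo x) hp)⟩
      chi := fun y => (C y).restrict (hNo' y) (hNV' y) }⟩⟩

/-! ### Construction of the bundle from local data -/

/-- If the trivialisations of `P → M` and of `P₊ → S` have the same transition functions in a
trivialisation of `S → R` over `V`, then they give a trivialisation of the tower over `V`. -/
theorem exists_compositeTrivialization {P : PrincipalBundle M G} {S : SmoothManifold.{u}}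
    {projS : S → R} {Q : PrincipalBundle S G} {V : Set R} {U : κ → Set M}
    (hU : IsOpenCoverFamily U)
    {eS : Bundle.Trivialization M projS} (heSV : eS.baseSet = V) (heS : IsSmoothTrivialization eS)
    {eP : κ → Bundle.Trivialization G P.proj} (hePU : ∀ α, (eP α).baseSet = U α)
    (heP : ∀ α, IsPrincipalTrivialization (eP α))
    {eQ : κ → Bundle.Trivialization G Q.proj}
    (heQW : ∀ α s, s ∈ (eQ α).baseSet ↔ projS s ∈ V ∧ (eS s).2 ∈ U α)
    (heQ : ∀ α, IsPrincipalTrivialization (eQ α)) (c : κ → κ → M → G)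
    (hcP : ∀ α β, ∀ x ∈ U α ∩ U β, ∀ v,
      eP β ((eP α).toOpenPartialHomeomorph.symm (x, v)) = (x, c α β x * v))
    (hcQ : ∀ α β s, projS s ∈ V → (eS s).2 ∈ U α ∩ U β → ∀ v,
      eQ β ((eQ α).toOpenPartialHomeomorph.symm (s, v)) = (s, c α β (eS s).2 * v)) :
    ∃ C : CompositeTrivialization P projS Q V, C.base = eS ∧
      ∀ α, ∀ y ∈ V, ∀ x ∈ U α, ∀ h,
        C.lift.toOpenPartialHomeomorph.symm (y, (eP α).toOpenPartialHomeomorph.symm (x, h)) =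
          (eQ α).toOpenPartialHomeomorph.symm (eS.toOpenPartialHomeomorph.symm (y, x), h) := by
  -- In coordinates χ* is to be the identity, so its inverse runs Q → S × G → (R × M) × G → R × (M ×
  -- G) → R × P.
  let L : κ → OpenPartialHomeomorph Q.Tot (R × P.Tot) := fun α =>
    (eQ α).toOpenPartialHomeomorph.trans
      ((eS.toOpenPartialHomeomorph.prod (OpenPartialHomeomorph.refl G)).trans
        ((Homeomorph.prodAssoc R M G).toOpenPartialHomeomorph.trans
          ((OpenPartialHomeomorph.refl R).prod (eP α).toOpenPartialHomeomorph.symm)))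
  have hassoc : (Homeomorph.prodAssoc R M G).toOpenPartialHomeomorph.IsSmooth
      ((R.I.prod M.I).prod G.I) (R.I.prod (M.I.prod G.I)) := by
    refine ⟨ContMDiff.contMDiffOn ?_, ContMDiff.contMDiffOn ?_⟩
    · exact (contMDiff_fst.comp contMDiff_fst).prodMk
        ((contMDiff_snd.comp contMDiff_fst).prodMk contMDiff_snd)
    · exact (contMDiff_fst.prodMk (contMDiff_fst.comp contMDiff_snd)).prodMk
        (contMDiff_snd.comp contMDiff_snd)
  have hL : ∀ α, (L α).IsSmooth Q.Tot.I (R.I.prod P.Tot.I) := fun α =>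
    OpenPartialHomeomorph.IsSmooth.trans (heQ α).1
      ((OpenPartialHomeomorph.IsSmooth.prod heS OpenPartialHomeomorph.isSmooth_refl).trans
        (hassoc.trans (OpenPartialHomeomorph.isSmooth_refl.prod
          (OpenPartialHomeomorph.IsSmooth.symm (heP α).1))))
  have heSsrc : ∀ s, s ∈ eS.source ↔ projS s ∈ V := fun s => by rw [eS.mem_source, heSV]
  have heS1 : ∀ s, projS s ∈ V → (eS s).1 = projS s := fun s hs => eS.coe_fst ((heSsrc s).2 hs)
  have hLsrc : ∀ α q, q ∈ (L α).source ↔ projS (Q.proj q) ∈ V ∧ (eS (Q.proj q)).2 ∈ U α := by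
    intro α q
    rw [← heQW, ← (eQ α).mem_source]
    refine ⟨fun h => h.1, fun h => ?_⟩
    have h1 : (eQ α q).1 = Q.proj q := (eQ α).coe_fst h
    have h2 := (heQW α _).1 ((eQ α).mem_source.1 h)
    refine ⟨h, ⟨?_, trivial⟩, trivial, trivial, ?_⟩
    · change (eQ α q).1 ∈ eS.source
      rw [h1, heSsrc]; exact h2.1
    · change ((eS (eQ α q).1).2, (eQ α q).2) ∈ (eP α).target
      rw [(eP α).mem_target, hePU, h1]; exact h2.2
  have hLapp : ∀ α q, projS (Q.proj q) ∈ V → (eS (Q.proj q)).2 ∈ U α →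
      L α q = (projS (Q.proj q),
        (eP α).toOpenPartialHomeomorph.symm ((eS (Q.proj q)).2, (eQ α q).2)) := by
    intro α q hV hα
    have h1 : (eQ α q).1 = Q.proj q :=
      (eQ α).coe_fst ((eQ α).mem_source.2 ((heQW α _).2 ⟨hV, hα⟩))
    change ((eS (eQ α q).1).1, (eP α).toOpenPartialHomeomorph.symm
      ((eS (eQ α q).1).2, (eQ α q).2)) = _
    rw [h1, heS1 _ hV]
  have hLtgt : ∀ α p, p ∈ (L α).target ↔ p.1 ∈ V ∧ P.proj p.2 ∈ U α := by
    rintro α ⟨y, p⟩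
    constructor
    · intro h
      have h1 := (L α).map_target h
      have h2 := (L α).right_inv h
      obtain ⟨h3, h4⟩ := (hLsrc α _).1 h1
      rw [hLapp α _ h3 h4] at h2
      obtain ⟨h5, h6⟩ := Prod.ext_iff.1 h2
      dsimp only at h5 h6
      refine ⟨h5 ▸ h3, ?_⟩
      dsimp only
      rw [← h6, (eP α).proj_symm_apply' (by rwa [hePU])]
      exact h4
    · rintro ⟨hy, hp⟩
      have hp' : p ∈ (eP α).source := (eP α).mem_source.2 (by rwa [hePU])
      refine ⟨⟨⟨⟨trivial, hp'⟩, trivial⟩, ?_, trivial⟩, ?_⟩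
      · change (y, (eP α p).1) ∈ eS.target
        rw [eS.mem_target, heSV]; exact hy
      · change (eS.toOpenPartialHomeomorph.symm (y, (eP α p).1), (eP α p).2) ∈ (eQ α).target
        rw [(eQ α).mem_target, heQW, eS.proj_symm_apply' (by rwa [heSV]),
          eS.apply_symm_apply' (by rwa [heSV]), (eP α).coe_fst hp']
        exact ⟨hy, hp⟩
  have hLsymm : ∀ α y p, P.proj p ∈ U α → (L α).symm (y, p) =
      (eQ α).toOpenPartialHomeomorph.symm
        (eS.toOpenPartialHomeomorph.symm (y, P.proj p), (eP α p).2) := by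
    intro α y p hp
    change (eQ α).toOpenPartialHomeomorph.symm
      (eS.toOpenPartialHomeomorph.symm (y, (eP α p).1), (eP α p).2) = _
    rw [(eP α).coe_fst' (by rwa [hePU])]
  -- Here and in `hP2` the G-coordinates of Q and of P change by the same left factor; therefore the
  -- `L α` agree on overlaps.
  have hQ2 : ∀ α β q, projS (Q.proj q) ∈ V → (eS (Q.proj q)).2 ∈ U α → (eS (Q.proj q)).2 ∈ U β →
      (eQ β q).2 = c α β (eS (Q.proj q)).2 * (eQ α q).2 := by
    intro α β q hV hα hβ
    have h1 := hcQ α β (Q.proj q) hV ⟨hα, hβ⟩ (eQ α q).2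
    rw [(eQ α).symm_apply_mk_proj ((eQ α).mem_source.2 ((heQW _ _).2 ⟨hV, hα⟩))] at h1
    exact congrArg Prod.snd h1
  have hP2 : ∀ α β p, P.proj p ∈ U α → P.proj p ∈ U β →
      (eP β p).2 = c α β (P.proj p) * (eP α p).2 := by
    intro α β p hα hβ
    have h1 := hcP α β (P.proj p) ⟨hα, hβ⟩ (eP α p).2
    rw [(eP α).symm_apply_mk_proj ((eP α).mem_source.2 (by rwa [hePU]))] at h1
    exact congrArg Prod.snd h1
  choose idx hidx using hU.2
  -- The two explicit functions only fill in values off the source and target; their G-coordinate 1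
  -- is arbitrary.
  obtain ⟨f, hfs, hft, hf, hf'⟩ := OpenPartialHomeomorph.exists_glue L
    ⟨fun q => (projS (Q.proj q), (eP (idx (eS (Q.proj q)).2)).toOpenPartialHomeomorph.symm
      ((eS (Q.proj q)).2, 1))⟩
    ⟨fun p => (eQ (idx (P.proj p.2))).toOpenPartialHomeomorph.symm
      (eS.toOpenPartialHomeomorph.symm (p.1, P.proj p.2), 1)⟩
    (by
      intro α β q hα hβ
      obtain ⟨hV, hα⟩ := (hLsrc α q).1 hα
      obtain ⟨-, hβ⟩ := (hLsrc β q).1 hβ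
      rw [hLapp α q hV hα, hLapp β q hV hβ, hQ2 α β q hV hα hβ]
      exact congrArg (Prod.mk _) ((eP α).symm_eq_symm_of_apply_eq (eP β) (by rwa [hePU])
        (by rwa [hePU]) (hcP α β _ ⟨hα, hβ⟩ _)))
    (by
      rintro α β ⟨y, p⟩ hα hβ
      obtain ⟨hV, hα⟩ := (hLtgt α _).1 hα
      obtain ⟨-, hβ⟩ := (hLtgt β _).1 hβ
      dsimp only at hV hα hβ
      have hs1 : projS (eS.toOpenPartialHomeomorph.symm (y, P.proj p)) = y :=
        eS.proj_symm_apply' (by rwa [heSV])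
      have hs2 : eS (eS.toOpenPartialHomeomorph.symm (y, P.proj p)) = (y, P.proj p) :=
        eS.apply_symm_apply' (by rwa [heSV])
      have h1 := hcQ α β (eS.toOpenPartialHomeomorph.symm (y, P.proj p)) (by rwa [hs1])
        (by rw [hs2]; exact ⟨hα, hβ⟩) (eP α p).2
      rw [hs2] at h1
      rw [hLsymm α y p hα, hLsymm β y p hβ, hP2 α β p hα hβ]
      refine (eQ α).symm_eq_symm_of_apply_eq (eQ β) ?_ ?_ h1
      all_goals
        rw [heQW, hs1, hs2]
        constructor <;> assumption)
  have hfsm := OpenPartialHomeomorph.IsSmooth.of_cover hL hfs hft hf hf'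
  have hfsrc : ∀ q, q ∈ f.source ↔ projS (Q.proj q) ∈ V := fun q => by
    rw [hfs, Set.mem_iUnion]
    simp only [hLsrc]
    exact ⟨fun ⟨_, h⟩ => h.1, fun h => ⟨_, h, hidx _⟩⟩
  have hftgt : ∀ p, p ∈ f.target ↔ p.1 ∈ V := fun p => by
    rw [hft, Set.mem_iUnion]
    simp only [hLtgt]
    exact ⟨fun ⟨_, h⟩ => h.1, fun h => ⟨_, h, hidx _⟩⟩
  have hfapp : ∀ q, projS (Q.proj q) ∈ V → ∃ α, (eS (Q.proj q)).2 ∈ U α ∧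
      f q = (projS (Q.proj q),
        (eP α).toOpenPartialHomeomorph.symm ((eS (Q.proj q)).2, (eQ α q).2)) := fun q hq =>
    ⟨_, hidx _, by rw [hf _ q ((hLsrc _ q).2 ⟨hq, hidx _⟩), hLapp _ q hq (hidx _)]⟩
  refine ⟨{
    base := eS
    baseSet_base := heSV
    smooth_base := heS
    lift :=
      { toOpenPartialHomeomorph := f
        baseSet := V
        open_baseSet := heSV ▸ eS.open_baseSet
        source_eq := Set.ext hfsrc
        target_eq := by ext p; simp [hftgt]
        proj_toFun := fun q hq => by
          obtain ⟨α, -, h⟩ := hfapp q ((hfsrc q).1 hq)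
          exact congrArg Prod.fst h }
    baseSet_lift := rfl
    smooth_lift := hfsm
    lift_action := ?_
    proj_lift := ?_ }, rfl, ?_⟩
  · intro q hq g
    change (f _).2 = MulOpposite.op g • (f q).2
    have hV : projS (Q.proj q) ∈ V := (hfsrc q).1 hq
    have hα := hidx (eS (Q.proj q)).2
    have hgq : Q.proj (MulOpposite.op g • q) = Q.proj q := Q.proj_action q g
    rw [hf _ q ((hLsrc _ q).2 ⟨hV, hα⟩), hf _ _ ((hLsrc _ _).2 (by rw [hgq]; exact ⟨hV, hα⟩)),
      hLapp _ q hV hα, hLapp _ _ (by rwa [hgq]) (by rwa [hgq]), hgq,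
      PrincipalBundle.smul_symm_apply (heP _) (by rwa [hePU]),
      (heQ _).2 q ((eQ _).mem_source.2 ((heQW _ _).2 ⟨hV, hα⟩))]
  · intro q hq
    obtain ⟨α, hα, h⟩ := hfapp q ((hfsrc q).1 hq)
    change P.proj (f q).2 = _
    rw [h, (eP α).proj_symm_apply' (by rwa [hePU])]
  · intro α y hy x hx h
    have hp : P.proj ((eP α).toOpenPartialHomeomorph.symm (x, h)) = x :=
      (eP α).proj_symm_apply' (by rwa [hePU])
    change f.symm _ = _
    rw [hf' α _ ((hLtgt α _).2 ⟨hy, by rwa [hp]⟩), hLsymm α y _ (by rwa [hp]), hp,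
      (eP α).apply_symm_apply' (by rwa [hePU])]

theorem CompositeLocalData.exists_atlas [Nonempty R] {U : κ → Set M} {V : ι → Set R}
    (D : CompositeLocalData G U V) (hU : IsOpenCoverFamily U) (hV : IsOpenCoverFamily V) :
    ∃ (B : PrincipalCompositeBundle R M G) (A : CompositeAtlas B U V), A.HasLocalData D := by
  obtain ⟨S, projS, eS, hprojS, heSV, heS, htS⟩ := SmoothManifold.exists_smoothBundle (F := M) hV
    (fun i j y x => D.φ i j y x) D.contMDiffOn_φ (fun i y hy x => D.φ_self hy x) D.φ_comp
  have hS2 : ∀ i j s, projS s ∈ V i → projS s ∈ V j →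
      (eS j s).2 = D.φ i j (projS s) (eS i s).2 := by
    intro i j s hi hj
    have h1 := htS i j (projS s) ⟨hi, hj⟩ (eS i s).2
    rw [(eS i).symm_apply_mk_proj ((eS i).mem_source.2 (by rwa [heSV]))] at h1
    exact congrArg Prod.snd h1
  obtain ⟨y₀⟩ := ‹Nonempty R›
  obtain ⟨i₀, hi₀⟩ := hV.2 y₀
  obtain ⟨P, eP, hePU, heP, htP⟩ := PrincipalBundle.exists_of_transition (B := M) (G := G) hU
    -- The indices are swapped: g^{(αi)(βj)} turns (βj)-coordinates into (αi)-coordinates, whereas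
    -- `exists_of_transition` wants the factor from its first index to its second. The same happens
    -- for P₊ below.
    (fun α β x => D.g β i₀ α i₀ x y₀)
    (fun α β => (D.contMDiffOn_g β i₀ α i₀).comp
      (contMDiff_id.prodMk contMDiff_const).contMDiffOn fun x hx =>
        ⟨hi₀, hi₀, hx.2, by simpa [D.φ_self hi₀] using hx.1⟩)
    (fun α β γ x hx => by
      have h := D.twisted_cocycle γ i₀ β i₀ α i₀ y₀ ⟨⟨hi₀, hi₀⟩, hi₀⟩ x hx.2
        (by rw [D.φ_self hi₀]; exact hx.1.2) (by rw [D.φ_self hi₀]; exact hx.1.1)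
      rwa [D.φ_self hi₀] at h)
  have hWopen : IsOpenCoverFamily
      (fun a : κ × ι => {s : S | projS s ∈ V a.2 ∧ (eS a.2 s).2 ∈ U a.1}) := by
    refine ⟨fun a => ?_, fun s => ?_⟩
    · have : {s : S | projS s ∈ V a.2 ∧ (eS a.2 s).2 ∈ U a.1} =
          (eS a.2).source ∩ eS a.2 ⁻¹' (Prod.snd ⁻¹' U a.1) := by
        ext s
        rw [Set.mem_inter_iff, (eS a.2).mem_source, heSV]
        rfl
      change IsOpen {s : S | projS s ∈ V a.2 ∧ (eS a.2 s).2 ∈ U a.1}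
      rw [this]
      exact (eS a.2).isOpen_inter_preimage ((hU.1 a.1).preimage continuous_snd)
    · obtain ⟨i, hi⟩ := hV.2 (projS s)
      obtain ⟨α, hα⟩ := hU.2 (eS i s).2
      exact ⟨(α, i), hi, hα⟩
  obtain ⟨Q, eQ, heQW, heQ, htQ⟩ := PrincipalBundle.exists_of_transition (B := S) (G := G) hWopen
    (fun a b s => D.g b.1 b.2 a.1 a.2 (eS b.2 s).2 (projS s))
    (fun a b => (D.contMDiffOn_g b.1 b.2 a.1 a.2).comp
      (f := fun s => ((eS b.2 s).2, projS s))
      ((contMDiff_snd.comp_contMDiffOn ((heS b.2).1.mono fun s hs =>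
        (eS b.2).mem_source.2 (by rw [heSV]; exact hs.2.1))).prodMk hprojS.contMDiffOn)
      fun s hs => ⟨hs.2.1, hs.1.1, hs.2.2, by
        have h := hS2 b.2 a.2 s hs.2.1 hs.1.1
        dsimp only
        rw [← h]
        exact hs.1.2⟩)
    (fun a b d s hs => by
      obtain ⟨⟨ha, hb⟩, hd⟩ := hs
      have h := D.twisted_cocycle d.1 d.2 b.1 b.2 a.1 a.2 (projS s) ⟨⟨hd.1, hb.1⟩, ha.1⟩
        (eS d.2 s).2 hd.2 (by rw [← hS2 _ _ s hd.1 hb.1]; exact hb.2)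
        (by rw [← hS2 _ _ s hd.1 ha.1]; exact ha.2)
      rwa [← hS2 _ _ s hd.1 hb.1] at h)
  have hC : ∀ i, ∃ C : CompositeTrivialization P projS Q (V i), C.base = eS i ∧
      ∀ α, ∀ y ∈ V i, ∀ x ∈ U α, ∀ h,
        C.lift.toOpenPartialHomeomorph.symm (y, (eP α).toOpenPartialHomeomorph.symm (x, h)) =
          (eQ (α, i)).toOpenPartialHomeomorph.symm
            ((eS i).toOpenPartialHomeomorph.symm (y, x), h) := fun i =>
    exists_compositeTrivialization hU (heSV i) (heS i) hePU heP
      (fun α s => by rw [heQW]; rfl) (fun α => heQ (α, i)) _ htP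
      -- Independence of y and i identifies the transition functions of P₊ over V i with those of P,
      -- which were taken at y₀ and i₀.
      (fun α β s hs hx v => by
        rw [htQ (α, i) (β, i) s ⟨⟨hs, hx.1⟩, hs, hx.2⟩ v]
        dsimp only
        rw [D.g_independent β α _ hx.symm i _ hs i₀ _ hi₀])
  choose C hCbase hClift using hC
  let B : PrincipalCompositeBundle R M G :=
    { P := P
      S := S
      projS := projS
      contMDiff_projS := hprojS
      Pplus := Q
      locally_trivial := fun y => (hV.2 y).elim fun i hi => ⟨V i, hi, ⟨C i⟩⟩ }
  refine ⟨B, {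
    trivP := eP
    baseSet_trivP := hePU
    principal_trivP := heP
    chi := C }, ⟨fun i j y hy x => ?_, fun α i β j y hy x hx hx' => ?_⟩⟩
  · change ((C j).base ((C i).base.toOpenPartialHomeomorph.symm (y, x))).2 = _
    rw [hCbase, hCbase, htS i j y hy]
  · change (C j).lift.toOpenPartialHomeomorph.symm
      (y, (eP β).toOpenPartialHomeomorph.symm (D.φ i j y x, 1)) =
      (C i).lift.toOpenPartialHomeomorph.symm
        (y, (eP α).toOpenPartialHomeomorph.symm (x, D.g α i β j x y))
    have hs := (eS i).symm_eq_symm_of_apply_eq (eS j) (by rw [heSV]; exact hy.1)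
      (by rw [heSV]; exact hy.2) (htS i j y hy x)
    have hs1 : projS ((eS i).toOpenPartialHomeomorph.symm (y, x)) = y :=
      (eS i).proj_symm_apply' (by rw [heSV]; exact hy.1)
    have hs2 : eS i ((eS i).toOpenPartialHomeomorph.symm (y, x)) = (y, x) :=
      (eS i).apply_symm_apply' (by rw [heSV]; exact hy.1)
    have hs3 : eS j ((eS i).toOpenPartialHomeomorph.symm (y, x)) = (y, D.φ i j y x) :=
      htS i j y hy x
    rw [hClift j β y hy.2 _ hx', hClift i α y hy.1 _ hx, ← hs]
    have hWi : projS ((eS i).toOpenPartialHomeomorph.symm (y, x)) ∈ V i ∧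
        (eS i ((eS i).toOpenPartialHomeomorph.symm (y, x))).2 ∈ U α := by
      rw [hs1, hs2]; exact ⟨hy.1, hx⟩
    have hWj : projS ((eS i).toOpenPartialHomeomorph.symm (y, x)) ∈ V j ∧
        (eS j ((eS i).toOpenPartialHomeomorph.symm (y, x))).2 ∈ U β := by
      rw [hs1, hs3]; exact ⟨hy.2, hx'⟩
    -- Both sides lie over the same point of S, and the factor from (β,j) to (α,i) there is
    -- g^{(αi)(βj)}(x,y).
    refine (eQ (β, j)).symm_eq_symm_of_apply_eq (eQ (α, i)) (by rw [heQW]; exact hWj)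
      (by rw [heQW]; exact hWi) ?_
    rw [htQ (β, j) (α, i) _ ⟨hWj, hWi⟩, mul_one]
    dsimp only
    rw [hs1, hs2]

end

theorem mainTheorem3 (R M G : SmoothManifold.{u}) [Nonempty R] [Group G] [LieGroup G.I ∞ G] :
    -- every principal composite bundle has local trivialisations over some good covers
    (∀ B : PrincipalCompositeBundle R M G, ∃ (κ ι : Type u) (U : κ → Set M) (V : ι → Set R),
      IsGoodCover U ∧ IsGoodCover V ∧ Nonempty (CompositeAtlas B U V)) ∧
    ∀ (κ ι : Type u) (U : κ → Set M) (V : ι → Set R), IsOpenCoverFamily U → IsOpenCoverFamily V →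
      -- its torsion and transition functions are local data of the required kind
      (∀ (B : PrincipalCompositeBundle R M G) (A : CompositeAtlas B U V),
        ∃ D : CompositeLocalData G U V, A.HasLocalData D) ∧
      ∀ D : CompositeLocalData G U V,
        -- all local data come from a principal composite bundle
        (∃ (B : PrincipalCompositeBundle R M G) (A : CompositeAtlas B U V), A.HasLocalData D) ∧
        -- which the data determine up to a unique isomorphism that respects the trivialisations
        (∀ (B B' : PrincipalCompositeBundle R M G) (A : CompositeAtlas B U V)
          (A' : CompositeAtlas B' U V), A.HasLocalData D → A'.HasLocalData D →
          ∃! F : CompositeIso B B', F.Preserves A A') ∧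
        -- and whose spaces `S` and `P₊` are obtained by gluing
        Equivalence D.baseRel ∧ Equivalence D.totalRel ∧
        ∀ (B : PrincipalCompositeBundle R M G) (A : CompositeAtlas B U V), A.HasLocalData D →
          ∃ (eS : D.GluedBase ≃ₜ B.S) (eP : D.GluedTotal ≃ₜ B.Pplus.Tot),
            (∀ (i : ι) (y : V i) (x : M),
              eS (Quot.mk D.baseRel ⟨i, y, x⟩) = A.chiInv i y x) ∧
            ∀ (a : κ × ι) (s : D.W a) (h : G),
              eP (Quot.mk D.totalRel ⟨a, s, h⟩) = A.phiPlus a.1 a.2 (eS s) h := by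
  refine ⟨fun B => B.exists_good_atlas, fun κ ι U V hU hV => ⟨fun B A => A.exists_hasLocalData,
    fun D => ⟨D.exists_atlas hU hV, fun B B' A A' hA hA' => ?_, D.baseRel_equivalence,
      D.totalRel_equivalence, fun B A hA => ?_⟩⟩⟩
  · obtain ⟨F, hF⟩ := hA.exists_iso hA' hU hV
    exact ⟨F, hF, fun F' hF' => hF'.unique hF hU hV⟩
  · obtain ⟨eS, heS⟩ := hA.exists_homeomorph_base hV
    obtain ⟨eP, heP⟩ := hA.exists_homeomorph_total hU hV eS heS
    exact ⟨eS, eP, heS, heP⟩
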